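/- Fourier transforms are $\hat f(\xi)=\int e^{-ix\cdot\xi}f(x)\,dx$ (extended to $L^2$), $\|f\|_{H^3}^2=\sum_{|\beta|\le 3}\|D^\beta f\|_{L^2}^2$, $\|(U,\Theta)\|_{L^\infty}=\|U\|_{L^\infty}+\|\Theta\|_{L^\infty}$, and $e_d=(0,\dots,0,1)$. Let $\nu,\lambda>0$ and $d\in\{2,3\}$. For initial data $U_0:\mathbb R^d\to\mathbb R^d$, $\Theta_0:\mathbb R^d\to\mathbb R$, let $(U,\Theta)$ be the smooth finite-energy solution ($U(t)\in L^2$ for all $t\ge 0$) on $[0,\infty)\times\mathbb R^d$ of the linearized damped Boussinesq system $$\partial_tU+\nu U+\nabla p=\Theta e_d,\qquad \partial_t\Theta+\lambda\Theta=0,\qquad \operatorname{div}U=0,\qquad (U,\Theta)|_{t=0}=(U_0,\Theta_0),$$ and put $$E_0=\int_0^\infty\big(\|U\cdot\nabla U\|_{H^3}+\|U\cdot\nabla\Theta\|_{H^3}\big)\,dt,\qquad F_0=\int_0^\infty\|(U,\Theta)\|_{L^\infty}\,dt .$$ For $K>0$ and functions $v_0,\vartheta_0$ consider the quantity $$\mathcal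 S_K(v_0,\vartheta_0,U,\Theta)=\big(\|v_0\|_{H^3}^2+\|\vartheta_0\|_{H^3}^2+E_0\big)\exp\big(KF_0+KE_0\big),$$ which is the left side of the smallness condition $\mathcal S_K\le\delta$ imposed on initial data $u_0=U_0+v_0$, $\theta_0=\Theta_0+\vartheta_0$ of the damped Boussinesq system. **Corollary 1.1.** For all $\nu,\lambda,K>0$ there is a constant $C>0$, depending only on $\nu,\lambda,K$, such that the following holds. Let $\varepsilon>0$ and let $a_0\in L^2(\mathbb R^d;\mathbb R)$ be smooth. * *Case $d=2$.* Suppose $$\operatorname{supp}\hat a_0\subset\widetilde{\mathcal C}=\Big\{\xi\in\mathbb R^2:\ |\xi_1-\xi_2|\le\varepsilon,\ \tfrac43\le|\xi|\le\tfrac32\Big\},$$ and let $v_0=\vartheta_0=0$, $U_0=\nabla^\perp a_0=(\partial_2a_0,-\partial_1a_0)$, $\Theta_0=a_0$. * *Case $d=3$.* Suppose $$\operatorname{supp}\hat a_0\subset\widetilde{\mathcal C}_0=\Big\{\xi\in\mathbb R^3:\ |\xi_1-\xi_2|\le\varepsilon,\ \tfrac{41}{30}\le|\xi_h|\le\tfrac{22}{15},\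 \varepsilon\le|\xi_3|\le2\varepsilon\Big\},\qquad \xi_h=(\xi_1,\xi_2),$$ where $\varepsilon$ is so small that $\widetilde{\mathcal C}_0\subset\{\tfrac43\le|\xi|\le\tfrac32\}$ (for instance $\varepsilon\le\frac1{10}$), and let $v_0=\vartheta_0=0$, $U_0=(\partial_2a_0,-\partial_1a_0,0)$, $\Theta_0=a_0$. In both cases the solution $(U,\Theta)$ exists, and every such solution satisfies $$E_0\le C\varepsilon\|a_0\|_{L^2}\|\hat a_0\|_{L^1},\qquad F_0\le C\|\hat a_0\|_{L^1},$$ and the left side of the smallness condition satisfies $$\mathcal S_K(0,0,U,\Theta)\le C\varepsilon\|a_0\|_{L^2}\|\hat a_0\|_{L^1}\exp\Big(C\varepsilon\|a_0\|_{L^2}\|\hat a_0\|_{L^1}+C\|\hat a_0\|_{L^1}\Big).$$ -/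

import Mathlib

open MeasureTheory Set
open scoped ENNReal ContDiff FourierTransform Gradient

noncomputable section

namespace DampedBoussinesq

/-- The Euclidean space `ℝ^d`. -/
abbrev Space (d : ℕ) : Type := EuclideanSpace ℝ (Fin d)

/-- The `i`-th vector of the canonical basis of `ℝ^d`. -/
def basisVec {d : ℕ} (i : Fin d) : Space d := EuclideanSpace.single i (1 : ℝ)

/-- The last vector `e_d = (0, ..., 0, 1)` of the canonical basis of `ℝ^d`. -/
def vertical (d : ℕ) : Space d := WithLp.toLp 2 fun i => if (i : ℕ) + 1 = d then 1 else 0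

/-- The classical partial derivative `∂_i f`. -/
def pderiv {d : ℕ} (i : Fin d) (f : Space d → ℝ) (x : Space d) : ℝ :=
  fderiv ℝ f x (basisVec i)

/-- The divergence of a vector field. -/
def divergence {d : ℕ} (V : Space d → Space d) (x : Space d) : ℝ :=
  ∑ i, fderiv ℝ V x (basisVec i) i

/-- The convective derivative `V · ∇ f = ∑ i, V_i ∂_i f` of a scalar or vector valued `f`. -/
def convect {d : ℕ} {F : Type*} [NormedAddCommGroup F] [NormedSpace ℝ F]
    (V : Space d → Space d) (f : Space d → F) (x : Space d) : F :=
  fderiv ℝ f x (V x)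

open Classical in
/-- The Sobolev norm `‖f‖_{H^3} = (∑_{|β| ≤ 3} ‖D^β f‖_{L²}²)^{1/2}` of a smooth function.
The multi-indices `β` of order `k` are listed as nondecreasing words `j : Fin k → Fin d`, so that
`D^β f = ∂_{j 0} ⋯ ∂_{j (k-1)} f`. -/
def h3Norm {d : ℕ} {F : Type*} [NormedAddCommGroup F] [NormedSpace ℝ F]
    (f : Space d → F) : ℝ≥0∞ :=
  (∑ k ∈ Finset.range 4, ∑ j : Fin k → Fin d with Monotone j,
    eLpNorm (fun x => iteratedFDeriv ℝ k f x fun i => basisVec (j i)) 2 volume ^ 2) ^ (1 / 2 : ℝ)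

/-- `(U, Θ)` is a smooth solution with finite energy on `[0, ∞) × ℝ^d` of the linearized damped
Boussinesq system
`∂_t U + ν U + ∇p = Θ e_d`, `∂_t Θ + λ Θ = 0`, `div U = 0`, `(U, Θ)|_{t = 0} = (U₀, Θ₀)`.
Time is the first variable; only the values at times `t ≥ 0` matter, and the time derivative at
`t = 0` is the one-sided one. -/
structure IsLinearSolution {d : ℕ} (ν lam : ℝ) (U₀ : Space d → Space d) (Θ₀ : Space d → ℝ)
    (U : ℝ → Space d → Space d) (Θ : ℝ → Space d → ℝ) : Prop where
  smooth_velocity :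
    ContDiffOn ℝ ∞ (fun z : ℝ × Space d => U z.1 z.2) (Ici (0 : ℝ) ×ˢ univ)
  smooth_temperature :
    ContDiffOn ℝ ∞ (fun z : ℝ × Space d => Θ z.1 z.2) (Ici (0 : ℝ) ×ˢ univ)
  finite_energy : ∀ t : ℝ, 0 ≤ t → MemLp (U t) 2 volume
  momentum : ∃ p : ℝ → Space d → ℝ, ∀ t : ℝ, 0 ≤ t → Differentiable ℝ (p t) ∧
    ∀ x, derivWithin (fun s => U s x) (Ici 0) t + ν • U t x + ∇ (p t) x = Θ t x • vertical d
  temperature : ∀ t : ℝ, 0 ≤ t → ∀ x,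
    derivWithin (fun s => Θ s x) (Ici 0) t + lam * Θ t x = 0
  incompressible : ∀ t : ℝ, 0 ≤ t → ∀ x, divergence (U t) x = 0
  initial_velocity : ∀ x, U 0 x = U₀ x
  initial_temperature : ∀ x, Θ 0 x = Θ₀ x

/-- `E₀ = ∫_0^∞ (‖U · ∇U‖_{H^3} + ‖U · ∇Θ‖_{H^3}) dt`. -/
def E0 {d : ℕ} (U : ℝ → Space d → Space d) (Θ : ℝ → Space d → ℝ) : ℝ≥0∞ :=
  ∫⁻ t in Ioi (0 : ℝ), (h3Norm (convect (U t) (U t)) + h3Norm (convect (U t) (Θ t)))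

/-- `F₀ = ∫_0^∞ ‖(U, Θ)‖_{L^∞} dt`, where `‖(U, Θ)‖_{L^∞} = ‖U‖_{L^∞} + ‖Θ‖_{L^∞}`. -/
def F0 {d : ℕ} (U : ℝ → Space d → Space d) (Θ : ℝ → Space d → ℝ) : ℝ≥0∞ :=
  ∫⁻ t in Ioi (0 : ℝ), (eLpNorm (U t) ∞ volume + eLpNorm (Θ t) ∞ volume)

/-- The left side `(‖v₀‖²_{H^3} + ‖ϑ₀‖²_{H^3} + E₀) exp (K F₀ + K E₀)` of the smallness condition,
with `K` the constant in the exponent. It is meant for finite norms, `E₀` and `F₀`. -/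
def smallnessLHS {d : ℕ} (K : ℝ) (v₀ : Space d → Space d) (ϑ₀ : Space d → ℝ)
    (U : ℝ → Space d → Space d) (Θ : ℝ → Space d → ℝ) : ℝ :=
  ((h3Norm v₀).toReal ^ 2 + (h3Norm ϑ₀).toReal ^ 2 + (E0 U Θ).toReal) *
    Real.exp (K * (F0 U Θ).toReal + K * (E0 U Θ).toReal)

/-- The Fourier transform `â(ξ) = ∫ e^{-i x·ξ} a(x) dx` of a real function `a ∈ L²(ℝ^d)`, defined
by Plancherel's theorem. Mathlib's transform has the kernel `e^{-2π i x·η}`, hence `η = ξ / 2π`. -/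
def hat {d : ℕ} {a : Space d → ℝ} (ha : MemLp (fun x => (a x : ℂ)) 2 volume)
    (ξ : Space d) : ℂ :=
  (𝓕 (ha.toLp (fun x => (a x : ℂ))) : Lp ℂ 2 (volume : Measure (Space d)))
    ((2 * Real.pi)⁻¹ • ξ)

/-- `supp â ⊆ S` for a closed set `S`: the function `â` vanishes almost everywhere off `S`. -/
def HatSupportedIn {d : ℕ} {a : Space d → ℝ} (ha : MemLp (fun x => (a x : ℂ)) 2 volume)
    (S : Set (Space d)) : Prop :=
  ∀ᵐ ξ ∂(volume : Measure (Space d)), ξ ∉ S → hat ha ξ = 0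

/-- The norm `‖a‖_{L²}`. -/
def normL2 {d : ℕ} (a : Space d → ℝ) : ℝ := (eLpNorm a 2 volume).toReal

/-- The norm `‖â‖_{L¹}`; it is finite when `â` has bounded support. -/
def normHatL1 {d : ℕ} {a : Space d → ℝ} (ha : MemLp (fun x => (a x : ℂ)) 2 volume) : ℝ :=
  (eLpNorm (hat ha) 1 volume).toReal

/-- The annulus `{4/3 ≤ |ξ| ≤ 3/2}`. -/
def annulus (d : ℕ) : Set (Space d) := {ξ | 4 / 3 ≤ ‖ξ‖ ∧ ‖ξ‖ ≤ 3 / 2}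

/-- The thin set `{|ξ₁ - ξ₂| ≤ ε, 4/3 ≤ |ξ| ≤ 3/2}` in `ℝ²`. -/
def thinSet2 (ε : ℝ) : Set (Space 2) := {ξ | |ξ 0 - ξ 1| ≤ ε ∧ 4 / 3 ≤ ‖ξ‖ ∧ ‖ξ‖ ≤ 3 / 2}

/-- The thin set `{|ξ₁ - ξ₂| ≤ ε, 41/30 ≤ |ξ_h| ≤ 22/15, ε ≤ |ξ₃| ≤ 2ε}` in `ℝ³`, where
`ξ_h = (ξ₁, ξ₂)`. -/
def thinSet3 (ε : ℝ) : Set (Space 3) :=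
  {ξ | |ξ 0 - ξ 1| ≤ ε ∧
    (41 / 30 ≤ √(ξ 0 ^ 2 + ξ 1 ^ 2) ∧ √(ξ 0 ^ 2 + ξ 1 ^ 2) ≤ 22 / 15) ∧
    (ε ≤ |ξ 2| ∧ |ξ 2| ≤ 2 * ε)}

/-- `∇^⊥ a = (∂₂ a, -∂₁ a)` in `ℝ²`. -/
def perpGrad2 (a : Space 2 → ℝ) (x : Space 2) : Space 2 :=
  !₂[pderiv 1 a x, -pderiv 0 a x]

/-- The field `(∂₂ a, -∂₁ a, 0)` in `ℝ³`. -/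
def perpGrad3 (a : Space 3 → ℝ) (x : Space 3) : Space 3 :=
  !₂[pderiv 1 a x, -pderiv 0 a x, 0]

end DampedBoussinesq

end

/-! The linearized system is solved explicitly by Fourier multipliers. The temperature is `exp(-λt)
a₀`. The velocity is `exp(-νt)` times the rotated gradient of `a₀` plus `c(t)` times the Leray
projection of `a₀ e_d`, where `c' + νc = exp(-λt)` and `c(0) = 0`; the rest of `a₀ e_d` is a
gradient and goes into the pressure (`isLinearSolution_multiplier`). All these symbols are bounded
on the annulus and decay exponentially in time, so the bound on `F₀` follows from `‖f‖_∞ ≤ ‖f̂‖_1`.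

For `E₀` the point is the factor `ε`. The convective term is rewritten as `U·∇f = (U₀+U₁)∂₀f +
U₁(∂₁-∂₀)f + ∑ U_i ∂_i f`, the last sum running over the other directions. On the thin set the
symbol of `∂₁-∂₀` is `O(ε)`, and so is that of `∂_i` in the other directions. The symbol of `U₀+U₁`
is also `O(ε)`: the rotated gradient contributes `i(ξ₁-ξ₀)`, and the Leray part is estimated in
`lerayVertical_thinSet2` and `lerayVertical_thinSet3`. So every product has a small factor. Putting
one factor in `L^∞` through `‖ĝ‖_1` and the other in `L²` through Plancherel gives
`h3Bounded_convect`; derivatives cost only constants, since frequencies are bounded. Integration in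
time gives `E0_F0_le`.

The bounds are claimed for every smooth finite-energy solution, so uniqueness is needed
(`IsLinearSolution.unique`). The curl of the difference of two velocities solves `w' = -νw` with
zero data, so the difference is curl free and divergence free. Its components are then harmonic and
in `L²`, and they vanish by Caccioppoli's inequality. -/

noncomputable section

namespace DampedBoussinesq

/-! ### Fourier multipliers acting on profiles with bounded frequencies. -/

section

variable {d : ℕ}

/-- The `L²` inverse Fourier transform is given by the integral on `L¹ ∩ L²`. -/
theorem coeFn_fourierInv_toLp {h : Space d → ℂ} (h1 : Integrable h) (h2 : MemLp h 2 volume) :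
    ((𝓕⁻ (h2.toLp h) : Lp ℂ 2 (volume : Measure (Space d))) : Space d → ℂ) =ᵐ[volume] 𝓕⁻ h := by
  have hcont : Continuous (𝓕⁻ h) := by
    have : 𝓕⁻ h = fun x => 𝓕 h (-x) := by
      ext x; exact Real.fourierInv_eq_fourier_neg h x
    rw [this]
    exact (VectorFourier.fourierIntegral_continuous Real.continuous_fourierChar
      (L := innerₗ (Space d)) continuous_inner h1).comp continuous_neg
  refine ae_eq_of_integral_contDiff_smul_eq ((Lp.memLp _).locallyIntegrable (by norm_num))
    hcont.locallyIntegrable ?_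
  -- A test function is Schwartz, so the `L²` transform can be moved onto it as a tempered
  -- distribution, and Fubini moves it back onto `h` as an integral.
  intro φ φs φc
  have c1 : HasCompactSupport (Complex.ofRealCLM ∘ φ) := φc.comp_left rfl
  have c2 : ContDiff ℝ ∞ (Complex.ofRealCLM ∘ φ) := by fun_prop
  set Φ := c1.toSchwartzMap c2
  have e1 := congrArg (fun T => T Φ) (Lp.fourierInv_toTemperedDistribution_eq (h2.toLp h))
  simp only [TemperedDistribution.fourierInv_apply, Lp.toTemperedDistribution_apply] at e1
  have e2 : ∫ x, φ x • (𝓕⁻ (h2.toLp h) : Lp ℂ 2 (volume : Measure (Space d))) x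
      = ∫ x, Φ x • (𝓕⁻ (h2.toLp h) : Lp ℂ 2 (volume : Measure (Space d))) x := by
    simp [Φ]
  have e3 : ∫ x, φ x • 𝓕⁻ h x = ∫ x, Φ x • 𝓕⁻ h x := by simp [Φ]
  rw [e2, e3, ← e1]
  have e4 : ∫ x, (𝓕⁻ Φ) x • (h2.toLp h : Lp ℂ 2 (volume : Measure (Space d))) x
      = ∫ x, (𝓕⁻ Φ) x • h x := by
    apply integral_congr_ae
    filter_upwards [h2.coeFn_toLp] with x hx
    rw [hx]
  rw [e4]
  -- `VectorFourier.fourierIntegral` carries a minus sign in the phase, so the form `-innerₗ` yields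
  -- the inverse transform.
  have e5 := VectorFourier.integral_fourierIntegral_smul_eq_flip (e := Real.fourierChar)
    (μ := (volume : Measure (Space d))) (ν := (volume : Measure (Space d)))
    (L := -innerₗ (Space d)) (f := Φ) (g := h)
    Real.continuous_fourierChar continuous_inner.neg Φ.integrable h1
  have e6 : (-innerₗ (Space d)).flip = -innerₗ (Space d) := by
    ext x y
    simp [real_inner_comm]
  rw [e6] at e5
  simpa [Real.fourierInv_eq, VectorFourier.fourierIntegral, SchwartzMap.fourierInv_coe] using e5

/-- Plancherel's theorem for the Fourier integral on `L¹ ∩ L²`. -/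
theorem eLpNorm_fourierInv {h : Space d → ℂ} (h1 : Integrable h) (h2 : MemLp h 2 volume) :
    eLpNorm (𝓕⁻ h) 2 volume = eLpNorm h 2 volume := by
  rw [← eLpNorm_congr_ae (coeFn_fourierInv_toLp h1 h2), ← Lp.enorm_def,
    ← eLpNorm_congr_ae h2.coeFn_toLp, ← Lp.enorm_def]
  have : ‖𝓕 (𝓕⁻ (h2.toLp h) : Lp ℂ 2 (volume : Measure (Space d)))‖ = _ := Lp.norm_fourier_eq _
  rw [FourierTransform.fourier_fourierInv_eq] at this
  rw [← ofReal_norm, ← ofReal_norm, this]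

/-- A function in `L¹ ∩ L²` which vanishes almost everywhere off `S / 2π`. -/
structure IsProfile (S : Set (Space d)) (g : Space d → ℂ) : Prop where
  integrable : Integrable g
  memLp : MemLp g 2 volume
  support : ∀ᵐ η, (2 * Real.pi) • η ∉ S → g η = 0

/-- A measurable Fourier symbol which is bounded by `M` on `S`. -/
structure IsSymbol (S : Set (Space d)) (M : ℝ) (m : Space d → ℂ) : Prop where
  measurable : Measurable m
  bound : ∀ ξ ∈ S, ‖m ξ‖ ≤ M

/-- The real part of the Fourier multiplier `m(D)` applied to the inverse Fourier transform
of `g`. -/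
def multiplier (m g : Space d → ℂ) (x : Space d) : ℝ :=
  (𝓕⁻ (fun η => m ((2 * Real.pi) • η) * g η) x).re

variable {S : Set (Space d)} {g m m₁ m₂ : Space d → ℂ} {M M₁ M₂ : ℝ}

theorem IsProfile.norm_mul_le (hg : IsProfile S g) (hm : IsSymbol S M m) :
    ∀ᵐ η, ‖m ((2 * Real.pi) • η) * g η‖ ≤ M * ‖g η‖ := by
  filter_upwards [hg.support] with η h
  by_cases hη : (2 * Real.pi) • η ∈ S
  · rw [norm_mul]
    exact mul_le_mul_of_nonneg_right (hm.bound _ hη) (norm_nonneg _)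
  · simp [h hη]

theorem IsProfile.aestronglyMeasurable (hg : IsProfile S g) (hm : IsSymbol S M m) :
    AEStronglyMeasurable (fun η => m ((2 * Real.pi) • η) * g η) volume :=
  ((hm.measurable.comp (measurable_const_smul _)).aestronglyMeasurable).mul
    hg.integrable.aestronglyMeasurable

theorem IsProfile.mul (hg : IsProfile S g) (hm : IsSymbol S M m) :
    IsProfile S (fun η => m ((2 * Real.pi) • η) * g η) where
  integrable := (hg.integrable.norm.const_mul M).mono' (hg.aestronglyMeasurable hm)
    (hg.norm_mul_le hm)
  memLp := hg.memLp.of_le_mul (hg.aestronglyMeasurable hm) (hg.norm_mul_le hm)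
  support := by
    filter_upwards [hg.support] with η h hη
    simp [h hη]

theorem IsProfile.eLpNorm_mul_le (hg : IsProfile S g) (hm : IsSymbol S M m) (p : ℝ≥0∞) :
    eLpNorm (fun η => m ((2 * Real.pi) • η) * g η) p volume
      ≤ ENNReal.ofReal M * eLpNorm g p volume :=
  eLpNorm_le_mul_eLpNorm_of_ae_le_mul (hg.norm_mul_le hm) p

theorem IsSymbol.add (h₁ : IsSymbol S M₁ m₁) (h₂ : IsSymbol S M₂ m₂) :
    IsSymbol S (M₁ + M₂) (fun ξ => m₁ ξ + m₂ ξ) :=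
  ⟨h₁.measurable.add h₂.measurable, fun ξ hξ =>
    (norm_add_le _ _).trans (add_le_add (h₁.bound ξ hξ) (h₂.bound ξ hξ))⟩

theorem IsSymbol.mul (h₁ : IsSymbol S M₁ m₁) (h₂ : IsSymbol S M₂ m₂) (h0 : 0 ≤ M₁) :
    IsSymbol S (M₁ * M₂) (fun ξ => m₁ ξ * m₂ ξ) :=
  ⟨h₁.measurable.mul h₂.measurable, fun ξ hξ => by
    rw [norm_mul]
    exact mul_le_mul (h₁.bound ξ hξ) (h₂.bound ξ hξ) (norm_nonneg _) h0⟩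

theorem enorm_multiplier_le (hg : IsProfile S g) (hm : IsSymbol S M m) (x : Space d) :
    ‖multiplier m g x‖ₑ ≤ ENNReal.ofReal M * eLpNorm g 1 volume := by
  refine le_trans ?_ (hg.eLpNorm_mul_le hm 1)
  have h1 : ‖multiplier m g x‖ ≤ ∫ η, ‖m ((2 * Real.pi) • η) * g η‖ := by
    refine (Complex.abs_re_le_norm _).trans ?_
    rw [Real.fourierInv_eq]
    refine (norm_integral_le_integral_norm _).trans (le_of_eq ?_)
    simp only [Circle.norm_smul]
  rw [← ofReal_norm, eLpNorm_one_eq_lintegral_enorm,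
    ← ofReal_integral_norm_eq_lintegral_enorm (hg.mul hm).integrable]
  exact ENNReal.ofReal_le_ofReal h1

theorem eLpNorm_multiplier_le (hg : IsProfile S g) (hm : IsSymbol S M m) :
    eLpNorm (multiplier m g) 2 volume ≤ ENNReal.ofReal M * eLpNorm g 2 volume := by
  refine le_trans ?_ (hg.eLpNorm_mul_le hm 2)
  rw [← eLpNorm_fourierInv (hg.mul hm).integrable (hg.mul hm).memLp]
  exact eLpNorm_mono fun x => Complex.abs_re_le_norm _

theorem multiplier_add (hg : IsProfile S g) (h₁ : IsSymbol S M₁ m₁) (h₂ : IsSymbol S M₂ m₂)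
    (x : Space d) :
    multiplier (fun ξ => m₁ ξ + m₂ ξ) g x = multiplier m₁ g x + multiplier m₂ g x := by
  unfold multiplier
  rw [← Complex.add_re]
  congr 1
  simp only [Real.fourierInv_eq, add_mul, smul_add]
  rw [integral_add]
  · exact (Real.fourierIntegral_convergent_iff (-x)).2 (hg.mul h₁).integrable |>.congr
      (by simp)
  · exact (Real.fourierIntegral_convergent_iff (-x)).2 (hg.mul h₂).integrable |>.congr
      (by simp)

theorem multiplier_const_mul (c : ℝ) (x : Space d) :
    multiplier (fun ξ => c * m ξ) g x = c * multiplier m g x := by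
  unfold multiplier
  rw [← Complex.re_ofReal_mul]
  congr 1
  simp only [Real.fourierInv_eq]
  rw [← smul_eq_mul (a := (c : ℂ)), ← integral_smul]
  congr 1
  ext η
  rw [mul_assoc, ← smul_eq_mul (a := (c : ℂ)), smul_comm]

/-- Identities between symbols that need `ξ ≠ 0` are only available on `S`, and that suffices
because the profile vanishes elsewhere. -/
theorem multiplier_congr (hg : IsProfile S g) (h : ∀ ξ ∈ S, m₁ ξ = m₂ ξ) (x : Space d) :
    multiplier m₁ g x = multiplier m₂ g x := by
  unfold multiplier
  rw [Real.fourierInv_congr_ae]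
  filter_upwards [hg.support] with η hη
  by_cases hS : (2 * Real.pi) • η ∈ S
  · rw [h _ hS]
  · simp [hη hS]

/-- Finite moments of all orders are what makes the inverse transform smooth and allows
differentiation under the integral. The factor `2π ≥ 1` between the two frequency scales is simply
discarded. -/
theorem IsProfile.integrable_pow (hg : IsProfile S g) {R : ℝ} (hR : ∀ ξ ∈ S, ‖ξ‖ ≤ R) (n : ℕ) :
    Integrable (fun η => ‖η‖ ^ n * ‖g η‖) := by
  refine (hg.integrable.norm.const_mul (R ^ n)).mono'
    ((by fun_prop : Continuous fun η : Space d => ‖η‖ ^ n).aestronglyMeasurable.mul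
      hg.integrable.norm.aestronglyMeasurable) ?_
  filter_upwards [hg.support] with η h
  by_cases hη : (2 * Real.pi) • η ∈ S
  · rw [Real.norm_of_nonneg (by positivity)]
    refine mul_le_mul_of_nonneg_right (pow_le_pow_left₀ (norm_nonneg _) ?_ _) (norm_nonneg _)
    have h1 := hR _ hη
    rw [norm_smul, Real.norm_of_nonneg Real.two_pi_pos.le] at h1
    nlinarith [norm_nonneg η, Real.two_le_pi]
  · simp [h hη]

theorem fourierInv_eq_comp_neg (h : Space d → ℂ) : 𝓕⁻ h = fun x => 𝓕 h (-x) :=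
  funext fun x => Real.fourierInv_eq_fourier_neg h x

theorem contDiff_multiplier (hg : IsProfile S g) (hm : IsSymbol S M m) {R : ℝ}
    (hR : ∀ ξ ∈ S, ‖ξ‖ ≤ R) : ContDiff ℝ ∞ (multiplier m g) := by
  have h := Real.contDiff_fourier (N := ⊤) fun n _ => (hg.mul hm).integrable_pow hR n
  unfold multiplier
  rw [fourierInv_eq_comp_neg]
  exact Complex.reCLM.contDiff.comp (h.comp contDiff_neg)

theorem fderiv_multiplier (hg : IsProfile S g) (hm : IsSymbol S M m) {R : ℝ}
    (hR : ∀ ξ ∈ S, ‖ξ‖ ≤ R) (x v : Space d) :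
    fderiv ℝ (multiplier m g) x v
      = multiplier (fun ξ => Complex.I * (inner ℝ ξ v : ℝ) * m ξ) g x := by
  have h1 := (hg.mul hm).integrable_pow hR 1
  simp only [pow_one] at h1
  have h := Real.hasFDerivAt_fourier (hg.mul hm).integrable h1 (-x)
  have h2 : HasFDerivAt (multiplier m g) _ x :=
    Complex.reCLM.hasFDerivAt.comp x
      ((h.comp x (hasFDerivAt_id x).neg).congr_of_eventuallyEq
        (Filter.Eventually.of_forall fun y => congrFun (fourierInv_eq_comp_neg _) y))
  rw [h2.fderiv]
  unfold multiplier
  rw [fourierInv_eq_comp_neg]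
  simp only [ContinuousLinearMap.comp_apply, neg_apply,
    ContinuousLinearMap.id_apply, Complex.reCLM_apply]
  congr 1
  rw [Real.fourier_continuousLinearMap_apply]
  · change 𝓕 (_ : Space d → ℂ) (-x) = 𝓕 (_ : Space d → ℂ) (-x)
    refine congrArg (fun F : Space d → ℂ => 𝓕 F (-x)) (funext fun η => ?_)
    change -(2 * Real.pi * Complex.I) • (inner ℝ η (-v) : ℝ) • (m ((2 * Real.pi) • η) * g η) = _
    simp [inner_smul_left]
    ring
  · refine ((hg.mul hm).integrable_pow hR 1 |>.const_mul (2 * Real.pi)).mono'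
      (((hg.mul hm).integrable.aestronglyMeasurable).fourierSMulRight (L := innerSL ℝ)) ?_
    refine Filter.Eventually.of_forall fun η => ?_
    rw [VectorFourier.norm_fourierSMulRight]
    have h3 : ‖(innerSL ℝ : Space d →L[ℝ] Space d →L[ℝ] ℝ) η‖ = ‖η‖ := innerSL_apply_norm ℝ η
    exact le_of_eq (by rw [h3, pow_one, mul_assoc])

end

/-! ### `H³` estimates for products and for the convective term. -/

section

variable {d : ℕ} {S : Set (Space d)} {g : Space d → ℂ}

/-- The symbol of `∂_i m(D)`. -/
def derivSymbol (i : Fin d) (m : Space d → ℂ) (ξ : Space d) : ℂ := Complex.I * (ξ i : ℂ) * m ξ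

theorem abs_coord_le_norm (ξ : Space d) (i : Fin d) : |ξ i| ≤ ‖ξ‖ := by
  simpa using PiLp.norm_apply_le ξ i

theorem isSymbol_I_mul {b : Space d → ℝ} {M B : ℝ} {m : Space d → ℂ} (hm : IsSymbol S M m)
    (hb : Measurable b) (hB : 0 ≤ B) (h : ∀ ξ ∈ S, |b ξ| ≤ B) :
    IsSymbol S (B * M) (fun ξ => Complex.I * (b ξ : ℂ) * m ξ) := by
  refine IsSymbol.mul ⟨by fun_prop, fun ξ hξ => ?_⟩ hm hB
  simpa using h ξ hξ

theorem IsSymbol.deriv {R M : ℝ} {m : Space d → ℂ} (hm : IsSymbol S M m) (hR : ∀ ξ ∈ S, ‖ξ‖ ≤ R)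
    (hR0 : 0 ≤ R) (i : Fin d) : IsSymbol S (R * M) (derivSymbol i m) :=
  isSymbol_I_mul hm (by fun_prop) hR0 fun ξ hξ => (abs_coord_le_norm ξ i).trans (hR ξ hξ)

theorem fderiv_multiplier_basisVec {R M : ℝ} {m : Space d → ℂ} (hg : IsProfile S g)
    (hm : IsSymbol S M m) (hR : ∀ ξ ∈ S, ‖ξ‖ ≤ R) (x : Space d) (i : Fin d) :
    fderiv ℝ (multiplier m g) x (basisVec i) = multiplier (derivSymbol i m) g x := by
  rw [fderiv_multiplier hg hm hR]
  unfold derivSymbol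
  simp [basisVec, EuclideanSpace.inner_single_right]

/-- The derivative peeled off is the innermost one, so in an induction on the order it acts on the
function first and merely changes the Fourier symbol. -/
theorem iteratedFDeriv_succ_apply_fderiv {F : Type*} [NormedAddCommGroup F] [NormedSpace ℝ F]
    {f : Space d → F} (hf : ContDiff ℝ ∞ f) (k : ℕ) (x : Space d) (v : Fin (k + 1) → Space d) :
    iteratedFDeriv ℝ (k + 1) f x v
      = iteratedFDeriv ℝ k (fun y => fderiv ℝ f y (v (Fin.last k))) x (Fin.init v) := by
  rw [iteratedFDeriv_succ_apply_right]
  have h : ContDiff ℝ ∞ (fderiv ℝ f) := hf.fderiv_right (by simp)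
  have := (ContinuousLinearMap.apply ℝ F (v (Fin.last k))).iteratedFDeriv_comp_left
    (f := fderiv ℝ f) (x := x) (i := k) (n := ∞) h.contDiffAt (by exact_mod_cast le_top)
  have h2 : (fun y => fderiv ℝ f y (v (Fin.last k)))
      = (ContinuousLinearMap.apply ℝ F (v (Fin.last k))) ∘ fderiv ℝ f := rfl
  rw [h2, this]
  rfl

theorem continuous_iteratedFDeriv_apply {F : Type*} [NormedAddCommGroup F] [NormedSpace ℝ F]
    {f : Space d → F} (hf : ContDiff ℝ ∞ f) (k : ℕ) (v : Fin k → Space d) :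
    Continuous fun x => iteratedFDeriv ℝ k f x v :=
  (ContinuousMultilinearMap.apply ℝ (fun _ : Fin k => Space d) F v).continuous.comp
    (hf.continuous_iteratedFDeriv (by exact_mod_cast le_top))

theorem eLpNorm_multiplier_mul_le {P Q : ℝ} {p q : Space d → ℂ} (hg : IsProfile S g)
    (hp : IsSymbol S P p) (hq : IsSymbol S Q q) :
    eLpNorm (fun x => multiplier p g x * multiplier q g x) 2 volume
      ≤ ENNReal.ofReal P * eLpNorm g 1 volume * (ENNReal.ofReal Q * eLpNorm g 2 volume) := by
  have hfin : ENNReal.ofReal P * eLpNorm g 1 volume ≠ ⊤ :=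
    ENNReal.mul_ne_top ENNReal.ofReal_ne_top
      (memLp_one_iff_integrable.2 hg.integrable).eLpNorm_ne_top
  refine (eLpNorm_le_mul_eLpNorm_of_ae_le_mul
    (c := (ENNReal.ofReal P * eLpNorm g 1 volume).toReal) (g := multiplier q g)
    (Filter.Eventually.of_forall fun x => ?_) 2).trans ?_
  · rw [norm_mul]
    refine mul_le_mul_of_nonneg_right ?_ (norm_nonneg _)
    rw [← toReal_enorm]
    exact ENNReal.toReal_mono hfin (enorm_multiplier_le hg hp x)
  · rw [ENNReal.ofReal_toReal hfin]
    gcongr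
    exact eLpNorm_multiplier_le hg hq

/-- By the Leibniz rule each derivative turns one product into two, and in each of them one symbol
bound gains a factor `R`; hence `(2R)^k`. The induction must range over all pairs of symbols. -/
theorem eLpNorm_iteratedFDeriv_multiplier_mul_le {R : ℝ} (hg : IsProfile S g) (hR0 : 0 ≤ R)
    (hR : ∀ ξ ∈ S, ‖ξ‖ ≤ R) (k : ℕ) (j : Fin k → Fin d) {P Q : ℝ} {p q : Space d → ℂ}
    (hP : 0 ≤ P) (hQ : 0 ≤ Q) (hp : IsSymbol S P p) (hq : IsSymbol S Q q) :
    eLpNorm (fun x => iteratedFDeriv ℝ k (fun x => multiplier p g x * multiplier q g x) x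
        fun i => basisVec (j i)) 2 volume
      ≤ ENNReal.ofReal ((2 * R) ^ k * (P * Q)) * (eLpNorm g 1 volume * eLpNorm g 2 volume) := by
  induction k generalizing p q P Q with
  | zero =>
    simp only [iteratedFDeriv_zero_apply]
    refine (eLpNorm_multiplier_mul_le hg hp hq).trans (le_of_eq ?_)
    rw [pow_zero, one_mul, ENNReal.ofReal_mul hP]
    ring
  | succ k ih =>
    have cp := contDiff_multiplier hg hp hR
    have cq := contDiff_multiplier hg hq hR
    have hp' := hp.deriv hR hR0 (j (Fin.last k))
    have hq' := hq.deriv hR hR0 (j (Fin.last k))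
    have cp' := contDiff_multiplier hg hp' hR
    have cq' := contDiff_multiplier hg hq' hR
    have e : ∀ x, iteratedFDeriv ℝ (k + 1) (fun x => multiplier p g x * multiplier q g x) x
          (fun i => basisVec (j i))
        = iteratedFDeriv ℝ k (fun x => multiplier (derivSymbol (j (Fin.last k)) p) g x
            * multiplier q g x) x (fun i => basisVec (Fin.init j i))
          + iteratedFDeriv ℝ k (fun x => multiplier p g x
            * multiplier (derivSymbol (j (Fin.last k)) q) g x) x
              (fun i => basisVec (Fin.init j i)) := by
      intro x
      rw [iteratedFDeriv_succ_apply_fderiv (cp.mul cq)]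
      have e1 : (fun y => fderiv ℝ (fun x => multiplier p g x * multiplier q g x) y
          (basisVec (j (Fin.last k))))
          = (fun x => multiplier (derivSymbol (j (Fin.last k)) p) g x * multiplier q g x)
            + fun x => multiplier p g x * multiplier (derivSymbol (j (Fin.last k)) q) g x := by
        ext y
        rw [fderiv_fun_mul (cp.differentiable (by simp) y) (cq.differentiable (by simp) y)]
        simp only [add_apply, smul_apply, smul_eq_mul, Pi.add_apply]
        rw [fderiv_multiplier_basisVec hg hp hR, fderiv_multiplier_basisVec hg hq hR]
        ring
      rw [e1, iteratedFDeriv_add_apply]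
      · rfl
      · exact ((cp'.mul cq).of_le (by exact_mod_cast le_top)).contDiffAt
      · exact ((cp.mul cq').of_le (by exact_mod_cast le_top)).contDiffAt
    simp_rw [e]
    refine (eLpNorm_add_le
      (continuous_iteratedFDeriv_apply (cp'.mul cq) k _).aestronglyMeasurable
      (continuous_iteratedFDeriv_apply (cp.mul cq') k _).aestronglyMeasurable
      (by norm_num)).trans ?_
    refine (add_le_add (ih (Fin.init j) (by positivity) hQ hp' hq)
      (ih (Fin.init j) hP (by positivity) hp hq')).trans (le_of_eq ?_)
    rw [← add_mul, ← ENNReal.ofReal_add (by positivity) (by positivity)]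
    congr 2
    ring

/-- A smooth function whose derivatives of order at most three are bounded by `B` in `L²`. -/
structure H3Bounded {F : Type*} [NormedAddCommGroup F] [NormedSpace ℝ F] (B : ℝ≥0∞)
    (f : Space d → F) : Prop where
  contDiff : ContDiff ℝ ∞ f
  bound : ∀ k < 4, ∀ j : Fin k → Fin d,
    eLpNorm (fun x => iteratedFDeriv ℝ k f x fun i => basisVec (j i)) 2 volume ≤ B

theorem H3Bounded.sum {ι : Type*} {s : Finset ι} {f : ι → Space d → ℝ} {B : ι → ℝ≥0∞}
    (h : ∀ i ∈ s, H3Bounded (B i) (f i)) :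
    H3Bounded (∑ i ∈ s, B i) (fun x => ∑ i ∈ s, f i x) where
  contDiff := ContDiff.sum fun i hi => (h i hi).contDiff
  bound k hk j := by
    have e : (fun x => iteratedFDeriv ℝ k (fun x => ∑ i ∈ s, f i x) x fun i => basisVec (j i))
        = ∑ l ∈ s, fun x => iteratedFDeriv ℝ k (f l) x fun i => basisVec (j i) := by
      ext x
      rw [iteratedFDeriv_fun_sum_apply fun i hi =>
        ((h i hi).contDiff.of_le (by exact_mod_cast le_top)).contDiffAt]
      simp
    rw [e]
    refine (eLpNorm_sum_le (fun i hi => (continuous_iteratedFDeriv_apply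
      (h i hi).contDiff k _).aestronglyMeasurable) (by norm_num)).trans ?_
    exact Finset.sum_le_sum fun i hi => (h i hi).bound k hk j

/-- The constant counts all words of length at most three, not only the monotone ones. The square
root is avoided through `c ≤ c²`. -/
theorem H3Bounded.h3Norm_le {F : Type*} [NormedAddCommGroup F] [NormedSpace ℝ F] {B : ℝ≥0∞}
    {f : Space d → F} (h : H3Bounded B f) :
    h3Norm f ≤ (∑ k ∈ Finset.range 4, d ^ k : ℕ) * B := by
  classical
  set c : ℕ := ∑ k ∈ Finset.range 4, d ^ k with hc
  have hc1 : 1 ≤ c := by simp [hc, Finset.sum_range_succ]; omega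
  have key : (∑ k ∈ Finset.range 4, ∑ j : Fin k → Fin d with Monotone j,
      eLpNorm (fun x => iteratedFDeriv ℝ k f x fun i => basisVec (j i)) 2 volume ^ 2)
      ≤ ((c : ℝ≥0∞) * B) ^ 2 := by
    calc _ ≤ ∑ k ∈ Finset.range 4, ∑ _j : Fin k → Fin d, B ^ 2 := by
          refine Finset.sum_le_sum fun k hk => ?_
          refine (Finset.sum_le_sum_of_subset (Finset.filter_subset _ _)).trans ?_
          refine Finset.sum_le_sum fun j _ => ?_
          exact pow_le_pow_left' (h.bound k (Finset.mem_range.1 hk) j) 2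
      _ = (c : ℝ≥0∞) * B ^ 2 := by
          simp [hc, Finset.sum_mul]
      _ ≤ (c : ℝ≥0∞) ^ 2 * B ^ 2 := by
          gcongr
          exact_mod_cast Nat.le_self_pow two_ne_zero c
      _ = _ := by rw [mul_pow]
  unfold h3Norm
  convert ENNReal.rpow_le_rpow key (by norm_num : (0 : ℝ) ≤ 1 / 2) using 1
  rw [← ENNReal.rpow_natCast, ← ENNReal.rpow_mul]
  norm_num

theorem contDiff_space_iff {f : Space d → Space d} :
    ContDiff ℝ ∞ f ↔ ∀ i, ContDiff ℝ ∞ (fun x => f x i) :=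
  contDiff_euclidean

theorem enorm_le_sum_enorm (v : Space d) : ‖v‖ₑ ≤ ∑ i, ‖v i‖ₑ := by
  have h : v = ∑ i, EuclideanSpace.single i (v i) := by
    ext j
    simp [Finset.sum_apply]
  conv_lhs => rw [h]
  refine (enorm_sum_le _ _).trans (Finset.sum_le_sum fun i _ => ?_)
  rw [← ofReal_norm, ← ofReal_norm, PiLp.norm_single]

theorem H3Bounded.of_coord {f : Space d → Space d} {B : ℝ≥0∞}
    (h : ∀ i, H3Bounded B (fun x => f x i)) : H3Bounded (d * B) f where
  contDiff := contDiff_space_iff.2 fun i => (h i).contDiff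
  bound k hk j := by
    have hf : ContDiff ℝ ∞ f := contDiff_space_iff.2 fun i => (h i).contDiff
    have e : ∀ (l : Fin d) (x : Space d), (iteratedFDeriv ℝ k f x fun i => basisVec (j i)) l
        = iteratedFDeriv ℝ k (fun x => f x l) x fun i => basisVec (j i) := by
      intro l x
      have := (EuclideanSpace.proj (𝕜 := ℝ) l : Space d →L[ℝ] ℝ).iteratedFDeriv_comp_left
        (f := f) (x := x) (i := k) (n := ∞) hf.contDiffAt (by exact_mod_cast le_top)
      have h2 : (fun x => f x l) = (EuclideanSpace.proj (𝕜 := ℝ) l : Space d →L[ℝ] ℝ) ∘ f := rfl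
      rw [h2, this]
      rfl
    calc _ ≤ eLpNorm (∑ l, fun x => ‖iteratedFDeriv ℝ k (fun x => f x l) x
            fun i => basisVec (j i)‖) 2 volume := by
          refine eLpNorm_mono_enorm fun x => ?_
          refine (enorm_le_sum_enorm _).trans (le_of_eq ?_)
          simp only [e, Finset.sum_apply]
          rw [Real.enorm_of_nonneg (Finset.sum_nonneg fun _ _ => norm_nonneg _),
            ENNReal.ofReal_sum_of_nonneg fun _ _ => norm_nonneg _]
          simp only [ofReal_norm]
      _ ≤ ∑ l : Fin d, B := by
          refine (eLpNorm_sum_le (fun l _ => (continuous_iteratedFDeriv_apply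
            (h l).contDiff k _).norm.aestronglyMeasurable) (by norm_num)).trans ?_
          refine Finset.sum_le_sum fun l _ => ?_
          rw [eLpNorm_norm]
          exact (h l).bound k hk j
      _ = _ := by simp

theorem h3Bounded_multiplier_mul (hg : IsProfile S g) (hS : S ⊆ annulus d) {P Q T : ℝ}
    {p q : Space d → ℂ} (hP : 0 ≤ P) (hQ : 0 ≤ Q) (hp : IsSymbol S P p) (hq : IsSymbol S Q q)
    (hT : P * Q ≤ T) :
    H3Bounded (ENNReal.ofReal (27 * T) * (eLpNorm g 1 volume * eLpNorm g 2 volume))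
      (fun x => multiplier p g x * multiplier q g x) where
  contDiff := (contDiff_multiplier hg hp fun ξ hξ => (hS hξ).2).mul
    (contDiff_multiplier hg hq fun ξ hξ => (hS hξ).2)
  bound k hk j := by
    refine (eLpNorm_iteratedFDeriv_multiplier_mul_le hg (by norm_num)
      (fun ξ hξ => (hS hξ).2) k j hP hQ hp hq).trans ?_
    gcongr
    -- On the annulus `R = 3/2`, so the loss is `3^k` with `k ≤ 3`.
    have : (2 * (3 / 2) : ℝ) ^ k ≤ 27 := by
      calc (2 * (3 / 2) : ℝ) ^ k ≤ (2 * (3 / 2) : ℝ) ^ 3 :=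
            pow_le_pow_right₀ (by norm_num) (by omega)
        _ = 27 := by norm_num
    exact this

/-- The vector field with Fourier symbol `v`. -/
def vectorMultiplier (v : Fin d → Space d → ℂ) (g : Space d → ℂ) (x : Space d) : Space d :=
  WithLp.toLp 2 fun i => multiplier (v i) g x

theorem eq_sum_coord_smul_basisVec (w : Space d) : w = ∑ i, w i • basisVec i := by
  ext j
  simp [basisVec, Finset.sum_apply, Pi.single_apply]

theorem convect_eq_sum {F : Type*} [NormedAddCommGroup F] [NormedSpace ℝ F]
    (V : Space d → Space d) (f : Space d → F) (x : Space d) :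
    convect V f x = ∑ i, V x i • fderiv ℝ f x (basisVec i) := by
  unfold convect
  conv_lhs => rw [eq_sum_coord_smul_basisVec (V x)]
  simp

/-- Frequencies which agree up to `2ε` in the first two directions and are at most `2ε` in the
others. -/
def IsThin (i₀ i₁ : Fin d) (ε : ℝ) (S : Set (Space d)) : Prop :=
  ∀ ξ ∈ S, |ξ i₁ - ξ i₀| ≤ 2 * ε ∧ ∀ i, i ≠ i₀ → i ≠ i₁ → |ξ i| ≤ 2 * ε

/-- The source of the factor `ε`: regrouping `V_{i₀}∂_{i₀} + V_{i₁}∂_{i₁}` as `(V_{i₀}+V_{i₁})∂_{i₀}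
+ V_{i₁}(∂_{i₁}-∂_{i₀})` leaves only products with one small symbol. -/
theorem h3Bounded_convect {i₀ i₁ : Fin d} (h01 : i₀ ≠ i₁) (hg : IsProfile S g)
    (hS : S ⊆ annulus d) {ε M N : ℝ} (hε : 0 ≤ ε) (hthin : IsThin i₀ i₁ ε S)
    {v : Fin d → Space d → ℂ} {m : Space d → ℂ} (hM : 0 ≤ M) (hN : 0 ≤ N)
    (hv : ∀ i, IsSymbol S M (v i)) (hv01 : IsSymbol S (M * ε) (fun ξ => v i₀ ξ + v i₁ ξ))
    (hm : IsSymbol S N m) :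
    H3Bounded (d * (ENNReal.ofReal (54 * (ε * M * N))
        * (eLpNorm g 1 volume * eLpNorm g 2 volume)))
      (convect (vectorMultiplier v g) (multiplier m g)) := by
  classical
  have hR : ∀ ξ ∈ S, ‖ξ‖ ≤ 3 / 2 := fun ξ hξ => (hS hξ).2
  set f : Fin d → Space d → ℝ := fun i x =>
    if i = i₀ then multiplier (fun ξ => v i₀ ξ + v i₁ ξ) g x * multiplier (derivSymbol i₀ m) g x
    else if i = i₁ then multiplier (v i₁) g x *
      multiplier (fun ξ => Complex.I * ((ξ i₁ - ξ i₀ : ℝ) : ℂ) * m ξ) g x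
    else multiplier (v i) g x * multiplier (derivSymbol i m) g x with hf
  have hdiff : IsSymbol S (2 * ε * N) (fun ξ => Complex.I * ((ξ i₁ - ξ i₀ : ℝ) : ℂ) * m ξ) :=
    isSymbol_I_mul hm (by fun_prop) (by positivity) fun ξ hξ => (hthin ξ hξ).1
  have e : convect (vectorMultiplier v g) (multiplier m g) = fun x => ∑ i, f i x := by
    ext x
    -- The regrouped sum differs termwise from the original one only at `i₀` and `i₁`, where the two
    -- discrepancies cancel.
    rw [convect_eq_sum, ← sub_eq_zero, ← Finset.sum_sub_distrib,
      Fintype.sum_eq_add i₀ i₁ h01]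
    · simp only [hf, if_true, h01.symm, if_false, smul_eq_mul]
      rw [fderiv_multiplier_basisVec hg hm hR, fderiv_multiplier_basisVec hg hm hR,
        multiplier_add hg (hv i₀) (hv i₁)]
      have e1 : multiplier (derivSymbol i₁ m) g x = multiplier (derivSymbol i₀ m) g x
          + multiplier (fun ξ => Complex.I * ((ξ i₁ - ξ i₀ : ℝ) : ℂ) * m ξ) g x := by
        rw [← multiplier_add hg (hm.deriv hR (by norm_num) i₀) hdiff]
        congr 1
        ext ξ
        simp only [derivSymbol]
        push_cast
        ring
      rw [e1]
      simp only [vectorMultiplier]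
      ring
    · rintro i ⟨hi0, hi1⟩
      simp only [hf, hi0, hi1, if_false, smul_eq_mul]
      rw [fderiv_multiplier_basisVec hg hm hR]
      simp [vectorMultiplier]
  rw [e]
  have := H3Bounded.sum (s := Finset.univ) (f := f)
    (B := fun _ => ENNReal.ofReal (54 * (ε * M * N))
        * (eLpNorm g 1 volume * eLpNorm g 2 volume)) ?_
  · simpa using this
  intro i _
  -- The factor `2` is the one in `2ε` from thinness. In the `i₀` term it covers the `3/2` lost to
  -- `∂_{i₀}`.
  have e54 : 54 * (ε * M * N) = 27 * (2 * (ε * M * N)) := by ring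
  rw [e54]
  by_cases hi0 : i = i₀
  · simp only [hf, hi0, if_true]
    refine h3Bounded_multiplier_mul hg hS (by positivity) (by positivity) hv01
      (hm.deriv hR (by norm_num) i₀) ?_
    nlinarith [show 0 ≤ ε * M * N by positivity]
  by_cases hi1 : i = i₁
  · simp only [hf, hi1, h01.symm, if_true, if_false]
    refine h3Bounded_multiplier_mul hg hS hM (by positivity) (hv i₁) hdiff (le_of_eq (by ring))
  · simp only [hf, hi0, hi1, if_false]
    refine h3Bounded_multiplier_mul hg hS hM (by positivity) (hv i)
      (isSymbol_I_mul hm (by fun_prop) (by positivity) fun ξ hξ => (hthin ξ hξ).2 i hi0 hi1)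
      (le_of_eq (by ring))

theorem fderiv_apply_coord {f : Space d → Space d} {x : Space d} (hf : DifferentiableAt ℝ f x)
    (w : Space d) (j : Fin d) : (fderiv ℝ f x w) j = fderiv ℝ (fun y => f y j) x w := by
  have h2 : (fun x => f x j) = (EuclideanSpace.proj (𝕜 := ℝ) j : Space d →L[ℝ] ℝ) ∘ f := rfl
  rw [h2, ((EuclideanSpace.proj (𝕜 := ℝ) j : Space d →L[ℝ] ℝ).hasFDerivAt.comp x
    hf.hasFDerivAt).fderiv]
  rfl

theorem contDiff_vectorMultiplier (hg : IsProfile S g) {R M : ℝ} (hR : ∀ ξ ∈ S, ‖ξ‖ ≤ R)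
    {v : Fin d → Space d → ℂ} (hv : ∀ i, IsSymbol S M (v i)) :
    ContDiff ℝ ∞ (vectorMultiplier v g) :=
  contDiff_space_iff.2 fun i => contDiff_multiplier hg (hv i) hR

theorem h3Bounded_convect_vector {i₀ i₁ : Fin d} (h01 : i₀ ≠ i₁) (hg : IsProfile S g)
    (hS : S ⊆ annulus d) {ε M N : ℝ} (hε : 0 ≤ ε) (hthin : IsThin i₀ i₁ ε S)
    {v w : Fin d → Space d → ℂ} (hM : 0 ≤ M) (hN : 0 ≤ N)
    (hv : ∀ i, IsSymbol S M (v i)) (hv01 : IsSymbol S (M * ε) (fun ξ => v i₀ ξ + v i₁ ξ))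
    (hw : ∀ i, IsSymbol S N (w i)) :
    H3Bounded (d * (d * (ENNReal.ofReal (54 * (ε * M * N))
        * (eLpNorm g 1 volume * eLpNorm g 2 volume))))
      (convect (vectorMultiplier v g) (vectorMultiplier w g)) := by
  refine H3Bounded.of_coord fun j => ?_
  have e : (fun x => convect (vectorMultiplier v g) (vectorMultiplier w g) x j)
      = convect (vectorMultiplier v g) (multiplier (w j) g) := by
    ext x
    unfold convect
    rw [fderiv_apply_coord ((contDiff_vectorMultiplier hg (fun ξ hξ => (hS hξ).2)
      hw).differentiable (by simp) x)]
    rfl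
  rw [e]
  exact h3Bounded_convect h01 hg hS hε hthin hM hN hv hv01 (hw j)

end

/-! ### A Liouville theorem for harmonic functions in `L²`. -/

section

variable {d : ℕ}

/-- Integration by parts against the constant `1`. -/
theorem integral_fderiv_eq_zero {f : Space d → ℝ} (hf : ContDiff ℝ ∞ f)
    (hc : HasCompactSupport f) (v : Space d) : ∫ x, fderiv ℝ f x v = 0 := by
  have h1 : Integrable (fun x => fderiv ℝ f x v) :=
    Continuous.integrable_of_hasCompactSupport (by
      have := hf.continuous_fderiv (by simp); fun_prop) (hc.fderiv_apply ℝ v)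
  have := integral_mul_fderiv_eq_neg_fderiv_mul_of_integrable (μ := (volume : Measure (Space d)))
    (f := f) (g := fun _ => (1 : ℝ)) (v := v) (by simpa using h1) (by simp)
    (by simpa using hf.continuous.integrable_of_hasCompactSupport hc)
    (fun x _ => hf.differentiable (by simp) x) (fun x _ => by fun_prop)
  simpa using this.symm

/-- A single bump function is dilated by `r`, so its gradient scales like `1/r` with `C` independent
of `r`. -/
theorem exists_cutoff (d : ℕ) : ∃ C : ℝ, 0 ≤ C ∧ ∀ r : ℝ, 0 < r → ∃ φ : Space d → ℝ,
    ContDiff ℝ ∞ φ ∧ HasCompactSupport φ ∧ (∀ x, 0 ≤ φ x ∧ φ x ≤ 1) ∧ (∀ x, ‖x‖ ≤ r → φ x = 1) ∧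
    (∀ x, φ x ≠ 0 → ‖x‖ ≤ 2 * r) ∧ ∀ x, ‖fderiv ℝ φ x‖ ≤ C / r := by
  let b : ContDiffBump (0 : Space d) := ⟨1, 2, one_pos, one_lt_two⟩
  have hb : ContDiff ℝ ∞ b := b.contDiff
  obtain ⟨C, hC⟩ := (hb.continuous_fderiv (by simp)).bounded_above_of_compact_support
    (b.hasCompactSupport.fderiv ℝ)
  refine ⟨C, (norm_nonneg _).trans (hC 0), fun r hr => ⟨fun x => b (r⁻¹ • x), ?_, ?_, ?_, ?_, ?_,
    ?_⟩⟩
  · exact hb.comp (contDiff_const_smul _)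
  · exact b.hasCompactSupport.comp_smul (inv_ne_zero hr.ne')
  · exact fun x => ⟨b.nonneg, b.le_one⟩
  · intro x hx
    refine b.one_of_mem_closedBall ?_
    rw [mem_closedBall_zero_iff, norm_smul, Real.norm_of_nonneg (by positivity)]
    change r⁻¹ * ‖x‖ ≤ 1
    rw [inv_mul_le_iff₀ hr]
    linarith
  · intro x hx
    have h : r⁻¹ • x ∈ Function.support b := hx
    rw [b.support_eq, mem_ball_zero_iff, norm_smul, Real.norm_of_nonneg (by positivity)] at h
    change r⁻¹ * ‖x‖ < 2 at h
    rw [inv_mul_lt_iff₀ hr] at h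
    linarith
  · intro x
    have h : HasFDerivAt (fun x => b (r⁻¹ • x)) _ x :=
      ((hb.differentiable (by simp) (r⁻¹ • x)).hasFDerivAt).comp x
        ((hasFDerivAt_id x).const_smul r⁻¹)
    rw [h.fderiv]
    refine (ContinuousLinearMap.opNorm_comp_le _ _).trans ?_
    rw [div_eq_mul_inv]
    refine mul_le_mul (hC _) ?_ (norm_nonneg _) ((norm_nonneg _).trans (hC 0))
    rw [norm_smul, Real.norm_of_nonneg (by positivity)]
    exact mul_le_of_le_one_right (by positivity) ContinuousLinearMap.norm_id_le

theorem integrable_sq_mul_of_hasCompactSupport {φ G : Space d → ℝ} (hφ : Continuous φ)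
    (hc : HasCompactSupport φ) (hG : Continuous G) : Integrable fun x => φ x ^ 2 * G x := by
  refine Continuous.integrable_of_hasCompactSupport (by fun_prop) ?_
  exact (hc.comp_left (g := fun t : ℝ => t ^ 2) (by simp)).mul_right

theorem norm_basisVec (i : Fin d) : ‖(basisVec i : Space d)‖ = 1 := by
  simp [basisVec]

theorem fderiv_eq_zero_of_basisVec {f : Space d → ℝ} {x : Space d}
    (h : ∀ i, fderiv ℝ f x (basisVec i) = 0) : fderiv ℝ f x = 0 := by
  ext w
  rw [eq_sum_coord_smul_basisVec w]
  simp [h]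

/-- Caccioppoli's inequality for a harmonic function. -/
theorem integral_cutoff_sq_mul_gradient_sq_le {u φ : Space d → ℝ} (hu : ContDiff ℝ ∞ u)
    (hharm : ∀ x, ∑ i, fderiv ℝ (fun y => fderiv ℝ u y (basisVec i)) x (basisVec i) = 0)
    (hφ : ContDiff ℝ ∞ φ) (hc : HasCompactSupport φ) :
    ∫ x, φ x ^ 2 * ∑ i, fderiv ℝ u x (basisVec i) ^ 2
      ≤ 4 * ∫ x, u x ^ 2 * ∑ i, fderiv ℝ φ x (basisVec i) ^ 2 := by
  have du : ∀ i : Fin d, ContDiff ℝ ∞ fun y => fderiv ℝ u y (basisVec i) := fun i =>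
    (hu.fderiv_right (by simp)).clm_apply contDiff_const
  have dφ : ∀ i : Fin d, ContDiff ℝ ∞ fun y => fderiv ℝ φ y (basisVec i) := fun i =>
    (hφ.fderiv_right (by simp)).clm_apply contDiff_const
  have hcs : ∀ i : Fin d, HasCompactSupport
      (fun y => φ y ^ 2 * (u y * fderiv ℝ u y (basisVec i))) := fun i =>
    (hc.comp_left (g := fun t : ℝ => t ^ 2) (by simp)).mul_right
  have hsm : ∀ i : Fin d, ContDiff ℝ ∞
      (fun y => φ y ^ 2 * (u y * fderiv ℝ u y (basisVec i))) := fun i =>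
    (hφ.pow 2).mul (hu.mul (du i))
  -- The integral of `div(φ² u ∇u)` vanishes; harmonicity removes the term with `Δu`.
  have h0 : ∫ x, ∑ i, fderiv ℝ (fun y => φ y ^ 2 * (u y * fderiv ℝ u y (basisVec i))) x
      (basisVec i) = 0 := by
    rw [integral_finsetSum]
    · exact Finset.sum_eq_zero fun i _ => integral_fderiv_eq_zero (hsm i) (hcs i) _
    · intro i _
      refine Continuous.integrable_of_hasCompactSupport ?_ ((hcs i).fderiv_apply ℝ _)
      have := (hsm i).continuous_fderiv (by simp)
      fun_prop
  have e0 : ∀ x, ∑ i, fderiv ℝ (fun y => φ y ^ 2 * (u y * fderiv ℝ u y (basisVec i))) x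
      (basisVec i) = ∑ i, (2 * φ x * fderiv ℝ φ x (basisVec i) * (u x * fderiv ℝ u x (basisVec i))
        + φ x ^ 2 * fderiv ℝ u x (basisVec i) ^ 2) := by
    intro x
    have : ∀ i, fderiv ℝ (fun y => φ y ^ 2 * (u y * fderiv ℝ u y (basisVec i))) x (basisVec i)
        = (2 * φ x * fderiv ℝ φ x (basisVec i) * (u x * fderiv ℝ u x (basisVec i))
        + φ x ^ 2 * fderiv ℝ u x (basisVec i) ^ 2)
        + φ x ^ 2 * u x * fderiv ℝ (fun y => fderiv ℝ u y (basisVec i)) x (basisVec i) := by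
      intro i
      have a1 := (hφ.differentiable (by simp) x).hasFDerivAt.pow 2
      have a2 := (hu.differentiable (by simp) x).hasFDerivAt
      have a3 := ((du i).differentiable (by simp) x).hasFDerivAt
      rw [(HasFDerivAt.fun_mul a1 (HasFDerivAt.fun_mul a2 a3)).fderiv]
      simp
      ring
    simp_rw [this]
    rw [Finset.sum_add_distrib (g := fun i => φ x ^ 2 * u x * _), ← Finset.mul_sum, hharm]
    simp
  simp_rw [e0] at h0
  -- Young's inequality for the cross term, that is, `(φ ∂u + 2u ∂φ)² ≥ 0`.
  have hpt : ∀ x, (1 / 2 : ℝ) * (φ x ^ 2 * ∑ i, fderiv ℝ u x (basisVec i) ^ 2)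
      - 2 * (u x ^ 2 * ∑ i, fderiv ℝ φ x (basisVec i) ^ 2)
      ≤ ∑ i, (2 * φ x * fderiv ℝ φ x (basisVec i) * (u x * fderiv ℝ u x (basisVec i))
        + φ x ^ 2 * fderiv ℝ u x (basisVec i) ^ 2) := by
    intro x
    simp only [Finset.mul_sum]
    rw [← Finset.sum_sub_distrib]
    refine Finset.sum_le_sum fun i _ => ?_
    nlinarith [sq_nonneg (φ x * fderiv ℝ u x (basisVec i) + 2 * u x * fderiv ℝ φ x (basisVec i))]
  have i1 : Integrable fun x => φ x ^ 2 * ∑ i, fderiv ℝ u x (basisVec i) ^ 2 :=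
    integrable_sq_mul_of_hasCompactSupport hφ.continuous hc
      (continuous_finsetSum _ fun i _ => (du i).continuous.pow 2)
  have i2 : Integrable fun x => u x ^ 2 * ∑ i, fderiv ℝ φ x (basisVec i) ^ 2 := by
    refine Continuous.integrable_of_hasCompactSupport ?_ ?_
    · exact (hu.continuous.pow 2).mul (continuous_finsetSum _ fun i _ => (dφ i).continuous.pow 2)
    · exact ((hc.fderiv ℝ).comp_left (g := fun L : Space d →L[ℝ] ℝ => ∑ i, L (basisVec i) ^ 2)
        (by simp)).mul_left
  have i3 : Integrable fun x => ∑ i, (2 * φ x * fderiv ℝ φ x (basisVec i) *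
      (u x * fderiv ℝ u x (basisVec i)) + φ x ^ 2 * fderiv ℝ u x (basisVec i) ^ 2) := by
    refine integrable_finsetSum _ fun i _ => Continuous.integrable_of_hasCompactSupport ?_ ?_
    · have := (du i).continuous
      have := (dφ i).continuous
      have := hφ.continuous
      have := hu.continuous
      fun_prop
    · refine HasCompactSupport.add ?_ ?_
      · exact ((hc.mul_left (f := fun _ => (2 : ℝ))).mul_right).mul_right
      · exact (hc.comp_left (g := fun t : ℝ => t ^ 2) (by simp)).mul_right
  have := integral_mono ((i1.const_mul (1 / 2)).sub (i2.const_mul 2)) i3 hpt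
  simp only [Pi.sub_apply] at this
  rw [h0, integral_sub (i1.const_mul _) (i2.const_mul _), integral_const_mul,
    integral_const_mul] at this
  linarith

/-- A harmonic function in `L²(ℝ^d)` vanishes. -/
theorem eq_zero_of_harmonic_of_memLp [NeZero d] {u : Space d → ℝ} (hu : ContDiff ℝ ∞ u)
    (hharm : ∀ x, ∑ i, fderiv ℝ (fun y => fderiv ℝ u y (basisVec i)) x (basisVec i) = 0)
    (hL : MemLp u 2 volume) (x : Space d) : u x = 0 := by
  have du : ∀ i : Fin d, ContDiff ℝ ∞ fun y => fderiv ℝ u y (basisVec i) := fun i =>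
    (hu.fderiv_right (by simp)).clm_apply contDiff_const
  obtain ⟨C, hC0, hcut⟩ := exists_cutoff d
  have hsq : Integrable fun x => u x ^ 2 := by simpa using hL.integrable_sq
  set G : Space d → ℝ := fun x => ∑ i, fderiv ℝ u x (basisVec i) ^ 2 with hG
  have hGc : Continuous G := continuous_finsetSum _ fun i _ => (du i).continuous.pow 2
  have hG0 : ∀ x, 0 ≤ G x := fun x => Finset.sum_nonneg fun i _ => sq_nonneg _
  have hgrad : ∀ x, fderiv ℝ u x = 0 := by
    intro x
    -- The fixed cutoff `φ` localizes near `x`. Cutoffs `ψ` at scale `n` dominate it for large `n`,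
    -- and Caccioppoli bounds their weighted energy by a multiple of `n⁻²`.
    obtain ⟨φ, hφ, hφc, hφ01, hφ1, hφs, -⟩ := hcut (‖x‖ + 1) (by positivity)
    have hle : ∀ n : ℕ, 2 * (‖x‖ + 1) ≤ n →
        ∫ y, φ y ^ 2 * G y ≤ (4 * d * C ^ 2 * ∫ y, u y ^ 2) * (1 / (n : ℝ)) ^ 2 := by
      intro n hn
      have hn0 : (0 : ℝ) < n := lt_of_lt_of_le (by positivity) hn
      obtain ⟨ψ, hψ, hψc, hψ01, hψ1, -, hψd⟩ := hcut n hn0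
      have i1 := integrable_sq_mul_of_hasCompactSupport hψ.continuous hψc hGc
      have i0 := integrable_sq_mul_of_hasCompactSupport hφ.continuous hφc hGc
      have s1 : ∫ y, φ y ^ 2 * G y ≤ ∫ y, ψ y ^ 2 * G y := by
        refine integral_mono i0 i1 fun y => mul_le_mul_of_nonneg_right ?_ (hG0 y)
        by_cases hy : φ y = 0
        · simpa [hy] using sq_nonneg (ψ y)
        · rw [hψ1 y ((hφs y hy).trans hn)]
          exact pow_le_pow_left₀ (hφ01 y).1 (hφ01 y).2 2
      have s2 : ∫ y, u y ^ 2 * ∑ i, fderiv ℝ ψ y (basisVec i) ^ 2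
          ≤ ∫ y, u y ^ 2 * (d * (C / n) ^ 2) := by
        refine integral_mono_of_nonneg (Filter.Eventually.of_forall fun y => ?_)
          (hsq.mul_const _) (Filter.Eventually.of_forall fun y => ?_)
        · exact mul_nonneg (sq_nonneg _) (Finset.sum_nonneg fun i _ => sq_nonneg _)
        · refine mul_le_mul_of_nonneg_left ?_ (sq_nonneg _)
          have : ∀ i ∈ (Finset.univ : Finset (Fin d)),
              fderiv ℝ ψ y (basisVec i) ^ 2 ≤ (C / n) ^ 2 := by
            intro i _
            refine sq_le_sq' (neg_le_of_abs_le ?_) (le_of_abs_le ?_) <;>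
            · rw [← Real.norm_eq_abs]
              refine (ContinuousLinearMap.le_opNorm _ _).trans ?_
              rw [norm_basisVec, mul_one]
              exact hψd y
          simpa using Finset.sum_le_sum this
      rw [integral_mul_const] at s2
      have s3 := integral_cutoff_sq_mul_gradient_sq_le hu hharm hψ hψc
      calc _ ≤ _ := s1
        _ ≤ _ := s3
        _ ≤ 4 * ((∫ y, u y ^ 2) * (d * (C / n) ^ 2)) := by gcongr
        _ = _ := by ring
    have hlim : Filter.Tendsto (fun n : ℕ => (4 * d * C ^ 2 * ∫ y, u y ^ 2) * (1 / (n : ℝ)) ^ 2)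
        Filter.atTop (nhds 0) := by
      have := ((tendsto_one_div_atTop_nhds_zero_nat (𝕜 := ℝ)).pow 2).const_mul
        (4 * d * C ^ 2 * ∫ y, u y ^ 2)
      rwa [zero_pow two_ne_zero, mul_zero] at this
    have hle0 : ∫ y, φ y ^ 2 * G y ≤ 0 :=
      ge_of_tendsto hlim (by
        filter_upwards [Filter.eventually_ge_atTop ⌈2 * (‖x‖ + 1)⌉₊] with n hn
        exact hle n (Nat.ceil_le.1 hn))
    have hcont : Continuous fun y => φ y ^ 2 * G y := (hφ.continuous.pow 2).mul hGc
    have hzero : (fun y => φ y ^ 2 * G y) =ᵐ[volume] 0 := by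
      rw [← integral_eq_zero_iff_of_nonneg (fun y => mul_nonneg (sq_nonneg _) (hG0 y))
        (integrable_sq_mul_of_hasCompactSupport hφ.continuous hφc hGc)]
      exact le_antisymm hle0 (integral_nonneg fun y => mul_nonneg (sq_nonneg _) (hG0 y))
    have hzx := congrFun ((hcont.ae_eq_iff_eq volume continuous_zero).1 hzero) x
    rw [hφ1 x (by linarith)] at hzx
    have hGx : G x = 0 := by simpa using hzx
    refine fderiv_eq_zero_of_basisVec fun i => ?_
    have := (Finset.sum_eq_zero_iff_of_nonneg fun i _ => sq_nonneg _).1 hGx i (Finset.mem_univ i)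
    simpa using this
  have hconst : u = fun _ => u x := by
    ext y
    exact is_const_of_fderiv_eq_zero (hu.differentiable (by simp)) hgrad y x
  -- A constant in `L²` of a space of infinite measure is zero; the measure is infinite because the
  -- space is not compact when `d ≠ 0`.
  rw [hconst, memLp_const_iff (by norm_num) (by norm_num)] at hL
  have : Nontrivial (Space d) :=
    ⟨⟨basisVec 0, 0, fun h => by simpa [norm_basisVec] using congrArg norm h⟩⟩
  have : NoncompactSpace (Space d) := NormedSpace.noncompactSpace ℝ (Space d)
  rcases hL with h | h
  · exact h
  · rw [measure_univ_of_isAddLeftInvariant] at h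
    exact absurd h (lt_irrefl _)

end

/-! ### Uniqueness of smooth finite-energy solutions. -/

section

section SpaceTime

variable {E G : Type*} [NormedAddCommGroup E] [NormedSpace ℝ E] [NormedAddCommGroup G]
  [NormedSpace ℝ G] {f : ℝ → E → G}

theorem uniqueDiffOn_spaceTime : UniqueDiffOn ℝ (Ici (0 : ℝ) ×ˢ (univ : Set E)) :=
  (uniqueDiffOn_Ici 0).prod uniqueDiffOn_univ

theorem hasFDerivAt_slice_space {F : ℝ × E → G} {L : ℝ × E →L[ℝ] G} {t : ℝ} (ht : 0 ≤ t) {x : E}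
    (h : HasFDerivWithinAt F L (Ici (0 : ℝ) ×ˢ univ) (t, x)) :
    HasFDerivAt (fun y => F (t, y)) (L.comp (ContinuousLinearMap.inr ℝ ℝ E)) x := by
  rw [← hasFDerivWithinAt_univ]
  have h1 : HasFDerivWithinAt (fun y : E => (t, y)) (ContinuousLinearMap.inr ℝ ℝ E) univ x :=
    (hasFDerivAt_prodMk_right t x).hasFDerivWithinAt
  exact HasFDerivWithinAt.comp (g := F) (f := fun y : E => (t, y)) x h h1
    fun y _ => ⟨ht, mem_univ _⟩

theorem hasDerivWithinAt_slice_time {F : ℝ × E → G} {L : ℝ × E →L[ℝ] G} {t : ℝ} {x : E}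
    (h : HasFDerivWithinAt F L (Ici (0 : ℝ) ×ˢ univ) (t, x)) :
    HasDerivWithinAt (fun s => F (s, x)) (L (1, 0)) (Ici 0) t := by
  have h1 : HasDerivWithinAt (fun s : ℝ => (s, x)) ((1 : ℝ), (0 : E)) (Ici 0) t :=
    ((hasDerivAt_id t).prodMk (hasDerivAt_const t x)).hasDerivWithinAt
  exact HasFDerivWithinAt.comp_hasDerivWithinAt (l := F) (f := fun s : ℝ => (s, x)) t h h1
    fun s hs => ⟨hs, mem_univ _⟩

theorem contDiff_slice_space
    (hf : ContDiffOn ℝ ∞ (fun z : ℝ × E => f z.1 z.2) (Ici (0 : ℝ) ×ˢ univ)) {t : ℝ}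
    (ht : 0 ≤ t) : ContDiff ℝ ∞ (f t) := by
  rw [← contDiffOn_univ]
  exact hf.comp (f := fun y : E => (t, y)) (by fun_prop) fun y _ => ⟨ht, mem_univ _⟩

theorem hasDerivWithinAt_time
    (hf : ContDiffOn ℝ ∞ (fun z : ℝ × E => f z.1 z.2) (Ici (0 : ℝ) ×ˢ univ)) {t : ℝ}
    (ht : 0 ≤ t) (x : E) :
    HasDerivWithinAt (fun s => f s x)
      (fderivWithin ℝ (fun z : ℝ × E => f z.1 z.2) (Ici (0 : ℝ) ×ˢ univ) (t, x) (1, 0))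
      (Ici 0) t :=
  hasDerivWithinAt_slice_time (F := fun z : ℝ × E => f z.1 z.2)
    (hf.differentiableOn (by simp) (t, x) ⟨ht, mem_univ _⟩).hasFDerivWithinAt

/-- Time and space derivatives commute, up to the initial time. -/
theorem hasDerivWithinAt_fderiv
    (hf : ContDiffOn ℝ ∞ (fun z : ℝ × E => f z.1 z.2) (Ici (0 : ℝ) ×ˢ univ)) {t : ℝ}
    (ht : 0 ≤ t) (x e : E) :
    HasDerivWithinAt (fun s => fderiv ℝ (f s) x e)
      (fderiv ℝ (fun y => derivWithin (fun s => f s y) (Ici 0) t) x e) (Ici 0) t := by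
  set s : Set (ℝ × E) := Ici (0 : ℝ) ×ˢ univ with hs
  set F : ℝ × E → G := fun z => f z.1 z.2 with hF
  set D := fderivWithin ℝ F s with hD
  have hDs : ContDiffOn ℝ ∞ D s := hf.fderivWithin uniqueDiffOn_spaceTime (by simp)
  have hz : (t, x) ∈ s := ⟨ht, mem_univ _⟩
  set D2 := fderivWithin ℝ D s (t, x) with hD2
  have hD2' : HasFDerivWithinAt D D2 s (t, x) :=
    (hDs.differentiableOn (by simp) (t, x) hz).hasFDerivWithinAt
  have hFd : ∀ r, 0 ≤ r → ∀ y, HasFDerivWithinAt F (D (r, y)) s (r, y) := fun r hr y =>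
    (hf.differentiableOn (by simp) (r, y) ⟨hr, mem_univ _⟩).hasFDerivWithinAt
  -- Symmetry of second derivatives persists at `t = 0` because the closed half space is the closure
  -- of its interior.
  have hsymm : D2 (1, 0) (0, e) = D2 (0, e) (1, 0) := by
    refine (ContDiffWithinAt.isSymmSndFDerivWithinAt (n := ∞) (hf (t, x) hz)
      (by simpa using (WithTop.coe_le_coe.2 (le_top : (2 : ℕ∞) ≤ ⊤)))
      uniqueDiffOn_spaceTime ?_ hz).eq _ _
    rw [hs, interior_prod_eq, closure_prod_eq, interior_Ici, closure_Ioi, interior_univ,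
      closure_univ]
    exact hz
  have e1 : ∀ r, 0 ≤ r → fderiv ℝ (f r) x e = D (r, x) (0, e) := by
    intro r hr
    rw [(hasFDerivAt_slice_space hr (hFd r hr x)).fderiv]
    rfl
  have e2 : ∀ y, derivWithin (fun s => f s y) (Ici 0) t = D (t, y) (1, 0) := fun y =>
    (hasDerivWithinAt_time hf ht y).derivWithin (uniqueDiffOn_Ici 0 t ht)
  have d1 : HasDerivWithinAt (fun r => D (r, x) (0, e)) (D2 (1, 0) (0, e)) (Ici 0) t := by
    have := (hasDerivWithinAt_slice_time hD2').clm_apply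
      (hasDerivWithinAt_const t (Ici 0) ((0 : ℝ), e))
    simpa using this
  have d2 : HasFDerivAt (fun y => D (t, y) (1, 0)) _ x :=
    (hasFDerivAt_slice_space ht hD2').clm_apply (hasFDerivAt_const ((1 : ℝ), (0 : E)) x)
  simp_rw [e2]
  rw [d2.fderiv]
  have e3 : D2 (1, 0) (0, e) = D2 (0, e) (1, 0) := hsymm
  refine (d1.congr (fun r hr => e1 r hr) (e1 t ht)).congr_deriv ?_
  simp [e3]

theorem contDiff_derivWithin_time
    (hf : ContDiffOn ℝ ∞ (fun z : ℝ × E => f z.1 z.2) (Ici (0 : ℝ) ×ˢ univ)) {t : ℝ}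
    (ht : 0 ≤ t) : ContDiff ℝ ∞ (fun y => derivWithin (fun s => f s y) (Ici 0) t) := by
  have hDs := hf.fderivWithin (m := ∞) uniqueDiffOn_spaceTime (by simp)
  have e2 : ∀ y, derivWithin (fun s => f s y) (Ici 0) t
      = fderivWithin ℝ (fun z : ℝ × E => f z.1 z.2) (Ici (0 : ℝ) ×ˢ univ) (t, y) (1, 0) := fun y =>
    (hasDerivWithinAt_time hf ht y).derivWithin (uniqueDiffOn_Ici 0 t ht)
  simp_rw [e2]
  refine ContDiff.clm_apply ?_ contDiff_const
  rw [← contDiffOn_univ]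
  exact hDs.comp (f := fun y : E => (t, y)) (by fun_prop) fun y _ => ⟨ht, mem_univ _⟩

end SpaceTime

/-- The integrating factor `exp(κt)` makes the product constant. -/
theorem eq_exp_mul_of_hasDerivWithinAt {κ : ℝ} {w : ℝ → ℝ}
    (hw : ∀ t, 0 ≤ t → HasDerivWithinAt w (-κ * w t) (Ici 0) t) {t : ℝ} (ht : 0 ≤ t) :
    w t = Real.exp (-κ * t) * w 0 := by
  have hd : ∀ s, 0 ≤ s → HasDerivWithinAt (fun s => Real.exp (κ * s) * w s) 0 (Ici 0) s := by
    intro s hs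
    have h1 : HasDerivWithinAt (fun s => Real.exp (κ * s)) (Real.exp (κ * s) * κ) (Ici 0) s := by
      simpa using (((hasDerivAt_id s).const_mul κ).exp).hasDerivWithinAt
    refine (h1.mul (hw s hs)).congr_deriv ?_
    ring
  have hc : ContinuousOn (fun s => Real.exp (κ * s) * w s) (Icc 0 t) := fun s hs =>
    ((hd s hs.1).continuousWithinAt).mono fun r hr => hr.1
  have := constant_of_has_deriv_right_zero hc
    (fun s hs => (hd s hs.1).mono fun r hr => hs.1.trans hr) t ⟨ht, le_rfl⟩
  simp only [mul_zero, Real.exp_zero, one_mul] at this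
  rw [← this, ← mul_assoc, ← Real.exp_add]
  simp

variable {d : ℕ}

theorem gradient_coord {q : Space d → ℝ} (x : Space d) (i : Fin d) :
    (∇ q x) i = fderiv ℝ q x (basisVec i) := by
  have h : inner ℝ (∇ q x) (basisVec i) = fderiv ℝ q x (basisVec i) := by
    unfold gradient
    rw [InnerProductSpace.toDual_symm_apply]
  rw [← h, basisVec, EuclideanSpace.inner_single_right]
  simp

/-- The pressure is only known to be differentiable. Smoothness of its gradient is what supplies the
second derivative, and symmetry then makes the curl of the gradient vanish. -/
theorem fderiv_gradient_symm {q : Space d → ℝ} (hq : Differentiable ℝ q)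
    (hs : ContDiff ℝ ∞ (∇ q)) (x : Space d) (i j : Fin d) :
    (fderiv ℝ (∇ q) x (basisVec i)) j = (fderiv ℝ (∇ q) x (basisVec j)) i := by
  have e : fderiv ℝ q = fun y => InnerProductSpace.toDual ℝ (Space d) (∇ q y) := by
    ext1 y
    simp [gradient]
  have hd : DifferentiableAt ℝ (fderiv ℝ q) x := by
    rw [e]
    exact (InnerProductSpace.toDual ℝ (Space d)).toContinuousLinearEquiv.differentiable.comp
      (hs.differentiable (by simp)) x
  have hsymm := second_derivative_symmetric (fun y => (hq y).hasFDerivAt) hd.hasFDerivAt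
  have key : ∀ a b : Fin d, (fderiv ℝ (∇ q) x (basisVec a)) b
      = fderiv ℝ (fderiv ℝ q) x (basisVec a) (basisVec b) := by
    intro a b
    rw [fderiv_apply_coord (hs.differentiable (by simp) x)]
    simp_rw [gradient_coord]
    rw [(hd.hasFDerivAt.clm_apply (hasFDerivAt_const (basisVec b) x)).fderiv]
    simp
  rw [key, key, hsymm]

/-- A solenoidal and irrotational field in `L²(ℝ^d)` vanishes. -/
theorem eq_zero_of_divergence_of_curl [NeZero d] {Y : Space d → Space d} (hY : ContDiff ℝ ∞ Y)
    (hL : MemLp Y 2 volume) (hdiv : ∀ x, divergence Y x = 0)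
    (hcurl : ∀ x (i j : Fin d), (fderiv ℝ Y x (basisVec i)) j = (fderiv ℝ Y x (basisVec j)) i)
    (x : Space d) : Y x = 0 := by
  have hYd := hY.differentiable (by simp)
  have hYi : ∀ i, ContDiff ℝ ∞ fun y => Y y i := contDiff_space_iff.1 hY
  have hY2 : ∀ i k : Fin d, ContDiff ℝ ∞ fun y => fderiv ℝ (fun z => Y z i) y (basisVec k) :=
    fun i k => ((hYi i).fderiv_right (by simp)).clm_apply contDiff_const
  ext j
  refine eq_zero_of_harmonic_of_memLp (hYi j) (fun x => ?_) ?_ x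
  -- Each component is harmonic: `ΔY_j = ∑ ∂_i∂_i Y_j = ∑ ∂_i∂_j Y_i = ∂_j div Y = 0`.
  · have h1 : ∀ i y, fderiv ℝ (fun z => Y z j) y (basisVec i)
        = fderiv ℝ (fun z => Y z i) y (basisVec j) := by
      intro i y
      rw [← fderiv_apply_coord (hYd y), hcurl, fderiv_apply_coord (hYd y)]
    have h2 : ∀ i, fderiv ℝ (fun y => fderiv ℝ (fun z => Y z i) y (basisVec j)) x (basisVec i)
        = fderiv ℝ (fun y => fderiv ℝ (fun z => Y z i) y (basisVec i)) x (basisVec j) := by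
      intro i
      have hd : DifferentiableAt ℝ (fderiv ℝ fun z => Y z i) x :=
        ((hYi i).fderiv_right (m := ∞) (by simp)).differentiable (by simp) x
      rw [(hd.hasFDerivAt.clm_apply (hasFDerivAt_const (basisVec j) x)).fderiv,
        (hd.hasFDerivAt.clm_apply (hasFDerivAt_const (basisVec i) x)).fderiv]
      simpa using second_derivative_symmetric
        (fun y => ((hYi i).differentiable (by simp) y).hasFDerivAt) hd.hasFDerivAt _ _
    simp_rw [h1, h2]
    have h3 : ∀ y, ∑ i, fderiv ℝ (fun z => Y z i) y (basisVec i) = 0 := by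
      intro y
      rw [← hdiv y]
      exact Finset.sum_congr rfl fun i _ => (fderiv_apply_coord (hYd y) _ _).symm
    have h4 : fderiv ℝ (fun y => ∑ i, fderiv ℝ (fun z => Y z i) y (basisVec i)) x (basisVec j)
        = 0 := by
      simp [h3]
    rw [fderiv_fun_sum fun i _ => (hY2 i i).differentiable (by simp) x] at h4
    simpa using h4
  · refine hL.mono (hYi j).continuous.aestronglyMeasurable
      (Filter.Eventually.of_forall fun y => PiLp.norm_apply_le _ _)

theorem IsLinearSolution.temperature_eq {ν lam : ℝ} {U₀ : Space d → Space d} {Θ₀ : Space d → ℝ}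
    {U : ℝ → Space d → Space d} {Θ : ℝ → Space d → ℝ} (h : IsLinearSolution ν lam U₀ Θ₀ U Θ)
    {t : ℝ} (ht : 0 ≤ t) (x : Space d) : Θ t x = Real.exp (-lam * t) * Θ₀ x := by
  rw [← h.initial_temperature x]
  refine eq_exp_mul_of_hasDerivWithinAt (w := fun s => Θ s x) (fun s hs => ?_) ht
  have h1 := hasDerivWithinAt_time h.smooth_temperature hs x
  refine h1.congr_deriv ?_
  rw [← h1.derivWithin (uniqueDiffOn_Ici 0 s hs)]
  linarith [h.temperature s hs x]

/-- Smooth solutions with finite energy of the linearized system are unique. -/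
theorem IsLinearSolution.unique [NeZero d] {ν lam : ℝ} {U₀ : Space d → Space d}
    {Θ₀ : Space d → ℝ} {U₁ U₂ : ℝ → Space d → Space d} {Θ₁ Θ₂ : ℝ → Space d → ℝ}
    (h₁ : IsLinearSolution ν lam U₀ Θ₀ U₁ Θ₁) (h₂ : IsLinearSolution ν lam U₀ Θ₀ U₂ Θ₂)
    {t : ℝ} (ht : 0 ≤ t) : U₁ t = U₂ t ∧ Θ₁ t = Θ₂ t := by
  have hΘ : ∀ s, 0 ≤ s → ∀ x, Θ₁ s x = Θ₂ s x := fun s hs x => by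
    rw [h₁.temperature_eq hs, h₂.temperature_eq hs]
  refine ⟨?_, funext (hΘ t ht)⟩
  obtain ⟨p₁, hp₁⟩ := h₁.momentum
  obtain ⟨p₂, hp₂⟩ := h₂.momentum
  set V : ℝ → Space d → Space d := fun s x => U₁ s x - U₂ s x with hV
  have hVs : ContDiffOn ℝ ∞ (fun z : ℝ × Space d => V z.1 z.2) (Ici (0 : ℝ) ×ˢ univ) :=
    h₁.smooth_velocity.sub h₂.smooth_velocity
  have hVd : ∀ s, 0 ≤ s → Differentiable ℝ (V s) := fun s hs =>
    (contDiff_slice_space hVs hs).differentiable (by simp)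
  have hV0 : V 0 = fun _ => 0 := by
    ext1 x
    simp [hV, h₁.initial_velocity, h₂.initial_velocity]
  have heq : ∀ s, 0 ≤ s → ∃ q : Space d → ℝ, Differentiable ℝ q ∧
      ∀ x, derivWithin (fun r => V r x) (Ici 0) s = -ν • V s x - ∇ q x := by
    intro s hs
    refine ⟨fun x => p₁ s x - p₂ s x, (hp₁ s hs).1.sub (hp₂ s hs).1, fun x => ?_⟩
    have e1 := (hp₁ s hs).2 x
    have e2 := (hp₂ s hs).2 x
    have d1 := hasDerivWithinAt_time h₁.smooth_velocity hs x
    have d2 := hasDerivWithinAt_time h₂.smooth_velocity hs x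
    have eg : ∇ (fun x => p₁ s x - p₂ s x) x = ∇ (p₁ s) x - ∇ (p₂ s) x := by
      unfold gradient
      rw [fderiv_fun_sub ((hp₁ s hs).1 x) ((hp₂ s hs).1 x), map_sub]
    have d12 : HasDerivWithinAt (fun r => V r x) _ (Ici 0) s := d1.sub d2
    rw [eg, d12.derivWithin (uniqueDiffOn_Ici 0 s hs),
      ← d1.derivWithin (uniqueDiffOn_Ici 0 s hs), ← d2.derivWithin (uniqueDiffOn_Ici 0 s hs)]
    rw [hΘ s hs x, ← e2] at e1
    rw [← sub_eq_zero] at e1 ⊢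
    rw [← e1]
    simp only [hV]
    module
  have hcurl : ∀ x (i j : Fin d), (fderiv ℝ (V t) x (basisVec i)) j
      = (fderiv ℝ (V t) x (basisVec j)) i := by
    intro x i j
    rw [← sub_eq_zero]
    -- Taking the curl eliminates the pressure and leaves a linear ODE at each point `x`.
    have hode : ∀ s, 0 ≤ s → HasDerivWithinAt
        (fun r => (fderiv ℝ (V r) x (basisVec i)) j - (fderiv ℝ (V r) x (basisVec j)) i)
        (-ν * ((fderiv ℝ (V s) x (basisVec i)) j - (fderiv ℝ (V s) x (basisVec j)) i))
        (Ici 0) s := by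
      intro s hs
      obtain ⟨q, hq, hqe⟩ := heq s hs
      have hW := contDiff_derivWithin_time hVs hs
      -- The momentum equation itself shows that the pressure gradient is smooth.
      have hgrad : ∇ q = fun x => -ν • V s x - derivWithin (fun r => V r x) (Ici 0) s := by
        ext1 y
        rw [hqe y]
        abel
      have hgs : ContDiff ℝ ∞ (∇ q) := by
        rw [hgrad]
        exact ((contDiff_slice_space hVs hs).const_smul (-ν)).sub hW
      have hder : ∀ a b : Fin d, HasDerivWithinAt (fun r => (fderiv ℝ (V r) x (basisVec a)) b)
          (-ν * (fderiv ℝ (V s) x (basisVec a)) b - (fderiv ℝ (∇ q) x (basisVec a)) b)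
          (Ici 0) s := by
        intro a b
        have h := hasDerivWithinAt_fderiv hVs hs x (basisVec a)
        have h' := (EuclideanSpace.proj (𝕜 := ℝ) b : Space d →L[ℝ] ℝ).hasFDerivAt
          |>.comp_hasDerivWithinAt s h
        refine h'.congr_deriv ?_
        simp_rw [hqe]
        have hνV : DifferentiableAt ℝ (fun y => -ν • V s y) x := ((hVd s hs).const_smul (-ν)) x
        rw [fderiv_fun_sub hνV (hgs.differentiable (by simp) x),
          fderiv_fun_const_smul (hVd s hs x)]
        simp
      refine ((hder i j).sub (hder j i)).congr_deriv ?_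
      rw [fderiv_gradient_symm hq hgs x i j]
      ring
    rw [eq_exp_mul_of_hasDerivWithinAt hode ht, hV0]
    simp
  have hdiv : ∀ x, divergence (V t) x = 0 := by
    intro x
    have c₁ := (contDiff_slice_space h₁.smooth_velocity ht).differentiable (by simp) x
    have c₂ := (contDiff_slice_space h₂.smooth_velocity ht).differentiable (by simp) x
    have e1 := h₁.incompressible t ht x
    have e2 := h₂.incompressible t ht x
    unfold divergence at e1 e2 ⊢
    simp only [hV]
    rw [fderiv_fun_sub c₁ c₂]
    simp [e1, e2]
  ext1 x
  exact sub_eq_zero.1 (eq_zero_of_divergence_of_curl (contDiff_slice_space hVs ht)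
    ((h₁.finite_energy t ht).sub (h₂.finite_energy t ht)) hdiv hcurl x)

end

/-! ### The Fourier profile of the initial datum. -/

section

variable {d : ℕ} {S : Set (Space d)}

/-- The Fourier transform of `a ∈ L²` in the normalization of Mathlib. -/
def fourierL2 {a : Space d → ℝ} (ha : MemLp (fun x => (a x : ℂ)) 2 volume) : Space d → ℂ :=
  (𝓕 (ha.toLp (fun x => (a x : ℂ))) : Lp ℂ 2 (volume : Measure (Space d)))

/-- Integrability comes for free: an `L²` function vanishing off a bounded set is in `L¹`. -/
theorem isProfile_fourierL2 {a : Space d → ℝ} (ha : MemLp (fun x => (a x : ℂ)) 2 volume)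
    {R : ℝ} (hS : ∀ ξ ∈ S, ‖ξ‖ ≤ R) (hsupp : HatSupportedIn ha S) :
    IsProfile S (fourierL2 ha) := by
  have hπ : (2 * Real.pi) ≠ 0 := Real.two_pi_pos.ne'
  have hmem : MemLp (fourierL2 ha) 2 volume := Lp.memLp _
  have hsup : ∀ᵐ η, (2 * Real.pi) • η ∉ S → fourierL2 ha η = 0 := by
    have hq : Measure.QuasiMeasurePreserving (fun η : Space d => (2 * Real.pi) • η) :=
      Measure.quasiMeasurePreserving_smul volume hπ
    filter_upwards [hq.ae hsupp] with η hη hηS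
    have := hη hηS
    unfold hat at this
    rwa [smul_smul, inv_mul_cancel₀ hπ, one_smul] at this
  refine ⟨?_, hmem, hsup⟩
  have hfin : IsFiniteMeasure (volume.restrict (Metric.closedBall (0 : Space d) R)) :=
    ⟨by rw [Measure.restrict_apply_univ]; exact measure_closedBall_lt_top⟩
  have h1 : IntegrableOn (fourierL2 ha) (Metric.closedBall (0 : Space d) R) :=
    (hmem.restrict _).integrable (by norm_num)
  refine h1.integrable_of_ae_notMem_eq_zero ?_
  filter_upwards [hsup] with η hη hηR
  refine hη fun hηS => hηR ?_
  have h2 := hS _ hηS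
  rw [norm_smul, Real.norm_of_nonneg Real.two_pi_pos.le] at h2
  rw [mem_closedBall_zero_iff]
  nlinarith [norm_nonneg η, Real.two_le_pi]

/-- The two normalizations differ by the dilation by `2π`, hence by the Jacobian `(2π)^d ≥ 1`; the
inequality is all that is needed. -/
theorem eLpNorm_fourierL2_one_le {a : Space d → ℝ} (ha : MemLp (fun x => (a x : ℂ)) 2 volume)
    (hg : Integrable (fourierL2 ha)) :
    eLpNorm (fourierL2 ha) 1 volume ≤ ENNReal.ofReal (normHatL1 ha) := by
  have hπ : (2 * Real.pi)⁻¹ ≠ 0 := inv_ne_zero Real.two_pi_pos.ne'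
  have e : eLpNorm (hat ha) 1 volume
      = ENNReal.ofReal ((2 * Real.pi) ^ d) * eLpNorm (fourierL2 ha) 1 volume := by
    have hh : Integrable (hat ha) := hg.comp_smul hπ
    rw [eLpNorm_one_eq_lintegral_enorm, eLpNorm_one_eq_lintegral_enorm,
      ← ofReal_integral_norm_eq_lintegral_enorm hh, ← ofReal_integral_norm_eq_lintegral_enorm hg,
      ← ENNReal.ofReal_mul (by positivity)]
    have h := Measure.integral_comp_smul (volume : Measure (Space d))
      (fun η => ‖fourierL2 ha η‖) (2 * Real.pi)⁻¹
    rw [finrank_euclideanSpace_fin, abs_of_pos (by positivity), inv_pow, inv_inv] at h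
    exact congrArg ENNReal.ofReal h
  have hfin : eLpNorm (fourierL2 ha) 1 volume ≠ ⊤ := (memLp_one_iff_integrable.2 hg).eLpNorm_ne_top
  unfold normHatL1
  rw [ENNReal.ofReal_toReal (by rw [e]; exact ENNReal.mul_ne_top ENNReal.ofReal_ne_top hfin), e]
  refine le_mul_of_one_le_left' ?_
  rw [ENNReal.one_le_ofReal]
  exact one_le_pow₀ (by nlinarith [Real.two_le_pi])

theorem eLpNorm_fourierL2_two {a : Space d → ℝ} (ha : MemLp (fun x => (a x : ℂ)) 2 volume) :
    eLpNorm (fourierL2 ha) 2 volume = ENNReal.ofReal (normL2 a) := by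
  have e : eLpNorm a 2 volume = eLpNorm (fun x => (a x : ℂ)) 2 volume :=
    eLpNorm_congr_norm_ae (Filter.Eventually.of_forall fun x => by simp)
  unfold normL2 fourierL2
  rw [ENNReal.ofReal_toReal (by rw [e]; exact ha.eLpNorm_ne_top), e,
    ← eLpNorm_congr_ae ha.coeFn_toLp, ← Lp.enorm_def, ← Lp.enorm_def,
    ← ofReal_norm, ← ofReal_norm, Lp.norm_fourier_eq]

/-- Fourier inversion holds almost everywhere, and both sides are continuous. -/
theorem eq_multiplier_one {a : Space d → ℝ} (ha : MemLp (fun x => (a x : ℂ)) 2 volume)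
    (hc : Continuous a) (hg : IsProfile S (fourierL2 ha)) {R : ℝ} (hR : ∀ ξ ∈ S, ‖ξ‖ ≤ R)
    (x : Space d) : a x = multiplier (fun _ => 1) (fourierL2 ha) x := by
  have h1 : IsSymbol S 1 (fun _ : Space d => (1 : ℂ)) := ⟨measurable_const, by simp⟩
  have hae : a =ᵐ[volume] multiplier (fun _ => 1) (fourierL2 ha) := by
    have h := coeFn_fourierInv_toLp hg.integrable hg.memLp
    have e : hg.memLp.toLp (fourierL2 ha) = 𝓕 (ha.toLp (fun x => (a x : ℂ))) :=
      Lp.toLp_coeFn _ _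
    rw [e, FourierTransform.fourierInv_fourier_eq] at h
    filter_upwards [h, ha.coeFn_toLp] with y hy hy'
    unfold multiplier
    simp only [one_mul]
    rw [← hy, hy', Complex.ofReal_re]
  exact congrFun ((hc.ae_eq_iff_eq volume (contDiff_multiplier hg h1 hR).continuous).1 hae) x

end

/-! ### The explicit solution of the linearized system. -/

section

variable {d : ℕ} {S : Set (Space d)} {g : Space d → ℂ}

/-- The solution of `c' + ν c = e^{-λ t}`, `c(0) = 0`, and its exponential decay. -/
theorem exists_duhamel_coefficient {ν lam : ℝ} (hν : 0 < ν) (hlam : 0 < lam) :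
    ∃ (c : ℝ → ℝ) (μ C : ℝ), 0 < μ ∧ 0 ≤ C ∧ ContDiff ℝ ∞ c ∧ c 0 = 0 ∧
      (∀ t, HasDerivAt c (-ν * c t + Real.exp (-lam * t)) t) ∧
      ∀ t, 0 ≤ t → |c t| ≤ C * Real.exp (-μ * t) ∧ Real.exp (-ν * t) ≤ Real.exp (-μ * t) ∧
        Real.exp (-lam * t) ≤ Real.exp (-μ * t) := by
  have hexp : ∀ κ t : ℝ, HasDerivAt (fun t => Real.exp (-κ * t)) (-κ * Real.exp (-κ * t)) t := by
    intro κ t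
    have := ((hasDerivAt_id t).const_mul (-κ)).exp
    simpa [mul_comm] using this
  -- In the resonant case `c(t) = t exp(-νt)`, and half of the decay rate is spent on absorbing the
  -- factor `t`.
  by_cases h : ν = lam
  · subst h
    refine ⟨fun t => t * Real.exp (-ν * t), ν / 2, 2 / ν, by positivity, by positivity,
      by fun_prop, by simp, fun t => ?_, fun t ht => ⟨?_, ?_, ?_⟩⟩
    · refine ((hasDerivAt_id t).mul (hexp ν t)).congr_deriv ?_
      simp
      ring
    · have h0 : |t * Real.exp (-ν * t)| = t * Real.exp (-ν * t) := abs_of_nonneg (by positivity)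
      rw [h0]
      have e : Real.exp (-ν * t) = Real.exp (-(ν / 2) * t) * Real.exp (-(ν / 2) * t) := by
        rw [← Real.exp_add]
        ring_nf
      have h1 : t * Real.exp (-(ν / 2) * t) ≤ 2 / ν := by
        have h2 : ν / 2 * t ≤ Real.exp (ν / 2 * t) := by
          linarith [Real.add_one_le_exp (ν / 2 * t)]
        rw [neg_mul, Real.exp_neg, ← div_eq_mul_inv, div_le_div_iff₀ (Real.exp_pos _) hν]
        linarith
      rw [e, ← mul_assoc]
      exact mul_le_mul_of_nonneg_right h1 (Real.exp_pos _).le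
    all_goals
      exact Real.exp_le_exp.2 (by nlinarith)
  · have hd : ν - lam ≠ 0 := sub_ne_zero.2 h
    have hmin : 0 < min ν lam := lt_min hν hlam
    have hle : ∀ t, 0 ≤ t → Real.exp (-ν * t) ≤ Real.exp (-min ν lam * t) ∧
        Real.exp (-lam * t) ≤ Real.exp (-min ν lam * t) := fun t ht =>
      ⟨Real.exp_le_exp.2 (by nlinarith [min_le_left ν lam]),
        Real.exp_le_exp.2 (by nlinarith [min_le_right ν lam])⟩
    refine ⟨fun t => (Real.exp (-lam * t) - Real.exp (-ν * t)) / (ν - lam), min ν lam,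
      2 / |ν - lam|, hmin, by positivity, by fun_prop, by simp, fun t => ?_, fun t ht => ⟨?_,
      hle t ht⟩⟩
    · refine (((hexp lam t).sub (hexp ν t)).div_const (ν - lam)).congr_deriv ?_
      field_simp
      ring
    · rw [abs_div, div_mul_eq_mul_div]
      refine div_le_div_of_nonneg_right ?_ (abs_nonneg _)
      have h1 := hle t ht
      rw [abs_le]
      constructor <;> linarith [Real.exp_pos (-lam * t), Real.exp_pos (-ν * t)]

/-- The symbol of the `i`-th component of the Leray projection of the vertical direction. -/
def lerayVertical (i : Fin d) (ξ : Space d) : ℝ :=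
  vertical d i - ξ i * inner ℝ ξ (vertical d) / ‖ξ‖ ^ 2

/-- The field `(∂₂ a, -∂₁ a)` in the plane spanned by the directions `i₀` and `i₁`. -/
def rotatedGradient (i₀ i₁ : Fin d) (a : Space d → ℝ) (x : Space d) : Space d :=
  WithLp.toLp 2 fun i => if i = i₀ then pderiv i₁ a x else if i = i₁ then -pderiv i₀ a x else 0

/-- The symbol of the rotated gradient. -/
def rotatedSymbol (i₀ i₁ i : Fin d) (ξ : Space d) : ℂ :=
  if i = i₀ then Complex.I * (ξ i₁ : ℂ) else if i = i₁ then -(Complex.I * (ξ i₀ : ℂ)) else 0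

/-- The symbol of the velocity, with the amplitudes `r` of the initial velocity and `c` of the
buoyancy. -/
def velocitySymbol (i₀ i₁ : Fin d) (r c : ℝ) (i : Fin d) (ξ : Space d) : ℂ :=
  r * rotatedSymbol i₀ i₁ i ξ + c * (lerayVertical i ξ : ℂ)

theorem isSymbol_one : IsSymbol S 1 (fun _ => (1 : ℂ)) := ⟨measurable_const, by simp⟩

theorem IsSymbol.mono {M N : ℝ} {m : Space d → ℂ} (h : IsSymbol S M m) (hMN : M ≤ N) :
    IsSymbol S N m := ⟨h.measurable, fun ξ hξ => (h.bound ξ hξ).trans hMN⟩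

theorem isSymbol_ofReal_mul {M : ℝ} {m : Space d → ℂ} (h : IsSymbol S M m) (c : ℝ) :
    IsSymbol S (|c| * M) (fun ξ => c * m ξ) :=
  IsSymbol.mul ⟨measurable_const, by simp⟩ h (abs_nonneg c)

theorem measurable_lerayVertical (i : Fin d) : Measurable (lerayVertical i) := by
  unfold lerayVertical
  have : Measurable fun ξ : Space d => inner ℝ ξ (vertical d) :=
    (continuous_id.inner continuous_const).measurable
  fun_prop

theorem pos_of_mem_annulus (hS : S ⊆ annulus d) {ξ : Space d} (hξ : ξ ∈ S) : 0 < ‖ξ‖ :=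
  lt_of_lt_of_le (by norm_num) (hS hξ).1

theorem isSymbol_rotatedSymbol (hS : S ⊆ annulus d) (i₀ i₁ i : Fin d) :
    IsSymbol S (3 / 2) (rotatedSymbol i₀ i₁ i) := by
  unfold rotatedSymbol
  have hb : ∀ (j : Fin d), ∀ ξ ∈ S, |ξ j| ≤ 3 / 2 := fun j ξ hξ =>
    (abs_coord_le_norm ξ j).trans (hS hξ).2
  split_ifs
  · exact ⟨by fun_prop, fun ξ hξ => by simpa using hb _ ξ hξ⟩
  · exact ⟨by fun_prop, fun ξ hξ => by simpa using hb _ ξ hξ⟩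
  · exact ⟨measurable_const, fun ξ hξ => by norm_num⟩

theorem isSymbol_lerayVertical (hS : S ⊆ annulus d) (i : Fin d) :
    IsSymbol S (2 * ‖vertical d‖) (fun ξ => (lerayVertical i ξ : ℂ)) := by
  refine ⟨Complex.measurable_ofReal.comp (measurable_lerayVertical i), fun ξ hξ => ?_⟩
  have hpos := pos_of_mem_annulus hS hξ
  rw [Complex.norm_real, Real.norm_eq_abs, two_mul]
  refine (abs_sub _ _).trans (add_le_add (abs_coord_le_norm _ _) ?_)
  rw [abs_div, abs_mul, abs_of_pos (by positivity : 0 < ‖ξ‖ ^ 2), div_le_iff₀ (by positivity)]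
  calc |ξ i| * |inner ℝ ξ (vertical d)| ≤ ‖ξ‖ * (‖ξ‖ * ‖vertical d‖) :=
        mul_le_mul (abs_coord_le_norm _ _) (abs_real_inner_le_norm _ _) (abs_nonneg _)
          (norm_nonneg _)
    _ = _ := by ring

theorem isSymbol_velocitySymbol (hS : S ⊆ annulus d) (i₀ i₁ : Fin d) (r c : ℝ) (i : Fin d) :
    IsSymbol S (|r| * (3 / 2) + |c| * (2 * ‖vertical d‖)) (velocitySymbol i₀ i₁ r c i) :=
  (isSymbol_ofReal_mul (isSymbol_rotatedSymbol hS i₀ i₁ i) r).add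
    (isSymbol_ofReal_mul (isSymbol_lerayVertical hS i) c)

/-- In the sum of the two components the rotated gradient leaves `i(ξ_{i₁}-ξ_{i₀})`, which is small
by thinness. The Leray part depends on the dimension and enters as `hleray`. -/
theorem isSymbol_velocitySymbol_add (hS : S ⊆ annulus d) {i₀ i₁ : Fin d} (h01 : i₀ ≠ i₁) {ε : ℝ}
    (hthin : IsThin i₀ i₁ ε S)
    (hleray : ∀ ξ ∈ S, |lerayVertical i₀ ξ + lerayVertical i₁ ξ| ≤ 3 * ε) (r c : ℝ) :
    IsSymbol S (|r| * (2 * ε) + |c| * (3 * ε))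
      (fun ξ => velocitySymbol i₀ i₁ r c i₀ ξ + velocitySymbol i₀ i₁ r c i₁ ξ) := by
  refine ⟨(isSymbol_velocitySymbol hS i₀ i₁ r c i₀).measurable.add
    (isSymbol_velocitySymbol hS i₀ i₁ r c i₁).measurable, fun ξ hξ => ?_⟩
  have e : velocitySymbol i₀ i₁ r c i₀ ξ + velocitySymbol i₀ i₁ r c i₁ ξ
      = r * (Complex.I * ((ξ i₁ - ξ i₀ : ℝ) : ℂ))
        + c * ((lerayVertical i₀ ξ + lerayVertical i₁ ξ : ℝ) : ℂ) := by
    simp only [velocitySymbol, rotatedSymbol, if_true, h01.symm, if_false]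
    push_cast
    ring
  rw [e]
  refine (norm_add_le _ _).trans (add_le_add ?_ ?_)
  · rw [norm_mul, norm_mul, Complex.norm_I, one_mul, Complex.norm_real, Complex.norm_real]
    exact mul_le_mul_of_nonneg_left (hthin ξ hξ).1 (abs_nonneg _)
  · rw [norm_mul, Complex.norm_real, Complex.norm_real]
    exact mul_le_mul_of_nonneg_left (hleray ξ hξ) (abs_nonneg _)

theorem multiplier_sum {M : ℝ} {ι : Type*} (hg : IsProfile S g) {v : ι → Space d → ℂ}
    (hv : ∀ i, IsSymbol S M (v i)) (s : Finset ι) (x : Space d) :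
    multiplier (fun ξ => ∑ i ∈ s, v i ξ) g x = ∑ i ∈ s, multiplier (v i) g x := by
  classical
  have hs : ∀ s : Finset ι, IsSymbol S (∑ _i ∈ s, M) (fun ξ => ∑ i ∈ s, v i ξ) := fun s =>
    ⟨Finset.measurable_sum s fun i _ => (hv i).measurable, fun ξ hξ =>
      (norm_sum_le _ _).trans (Finset.sum_le_sum fun i _ => (hv i).bound ξ hξ)⟩
  induction s using Finset.induction_on with
  | empty => simp [multiplier, Real.fourierInv_eq]
  | insert i s hi ih =>
    simp only [Finset.sum_insert hi]
    rw [multiplier_add hg (hv i) (hs s), ih]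

theorem divergence_vectorMultiplier {M R : ℝ} (hg : IsProfile S g) (hR : ∀ ξ ∈ S, ‖ξ‖ ≤ R)
    (hR0 : 0 ≤ R) {v : Fin d → Space d → ℂ} (hv : ∀ i, IsSymbol S M (v i)) (x : Space d) :
    divergence (vectorMultiplier v g) x
      = multiplier (fun ξ => ∑ i, derivSymbol i (v i) ξ) g x := by
  rw [multiplier_sum hg fun i => (hv i).deriv hR hR0 i]
  refine Finset.sum_congr rfl fun i _ => ?_
  rw [fderiv_apply_coord ((contDiff_vectorMultiplier hg hR hv).differentiable (by simp) x)]
  exact fderiv_multiplier_basisVec hg (hv i) hR x i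

/-- Both parts of the velocity symbol are orthogonal to `ξ`, the first as a rotation, the second as
a projection. -/
theorem sum_derivSymbol_velocitySymbol (hS : S ⊆ annulus d) {i₀ i₁ : Fin d} (h01 : i₀ ≠ i₁)
    (r c : ℝ) {ξ : Space d} (hξ : ξ ∈ S) :
    ∑ i, derivSymbol i (velocitySymbol i₀ i₁ r c i) ξ = 0 := by
  have hpos := pos_of_mem_annulus hS hξ
  have e1 : ∑ i, (ξ i : ℂ) * rotatedSymbol i₀ i₁ i ξ = 0 := by
    rw [Fintype.sum_eq_add i₀ i₁ h01]
    · simp only [rotatedSymbol, if_true, h01.symm, if_false]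
      ring
    · rintro i ⟨h0, h1⟩
      simp [rotatedSymbol, h0, h1]
  have e2 : ∑ i, ξ i * lerayVertical i ξ = 0 := by
    have h1 : ∑ i, ξ i * vertical d i = inner ℝ ξ (vertical d) := by
      simp [PiLp.inner_apply, mul_comm]
    have h2 : ∑ i, ξ i * ξ i = ‖ξ‖ ^ 2 := by
      rw [EuclideanSpace.real_norm_sq_eq]
      exact Finset.sum_congr rfl fun i _ => (sq (ξ i)).symm
    have h3 : ∀ i, ξ i * lerayVertical i ξ = ξ i * vertical d i
        - ξ i * ξ i * (inner ℝ ξ (vertical d) / ‖ξ‖ ^ 2) := fun i => by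
      unfold lerayVertical
      ring
    simp_rw [h3]
    rw [Finset.sum_sub_distrib, ← Finset.sum_mul, h1, h2]
    field_simp
    ring
  have e3 : ∀ i, derivSymbol i (velocitySymbol i₀ i₁ r c i) ξ
      = Complex.I * r * ((ξ i : ℂ) * rotatedSymbol i₀ i₁ i ξ)
        + Complex.I * c * ((ξ i * lerayVertical i ξ : ℝ) : ℂ) := fun i => by
    simp only [derivSymbol, velocitySymbol]
    push_cast
    ring
  simp_rw [e3]
  rw [Finset.sum_add_distrib, ← Finset.mul_sum, ← Finset.mul_sum, ← Complex.ofReal_sum, e1, e2]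
  simp

theorem memLp_vectorMultiplier {M R : ℝ} (hg : IsProfile S g) (hR : ∀ ξ ∈ S, ‖ξ‖ ≤ R)
    {v : Fin d → Space d → ℂ} (hv : ∀ i, IsSymbol S M (v i)) :
    MemLp (vectorMultiplier v g) 2 volume := by
  refine MemLp.of_eval_piLp fun i => ?_
  refine ⟨(contDiff_multiplier hg (hv i) hR).continuous.aestronglyMeasurable, ?_⟩
  exact (eLpNorm_multiplier_le hg (hv i)).trans_lt
    (ENNReal.mul_lt_top ENNReal.ofReal_lt_top hg.memLp.2)

/-- Separates time from space: smoothness and time derivatives of the solution reduce to those of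
the two scalar amplitudes. -/
theorem vectorMultiplier_velocitySymbol (hg : IsProfile S g) (hS : S ⊆ annulus d) (i₀ i₁ : Fin d)
    (r c : ℝ) (x : Space d) :
    vectorMultiplier (velocitySymbol i₀ i₁ r c) g x
      = r • vectorMultiplier (rotatedSymbol i₀ i₁) g x
        + c • vectorMultiplier (fun i ξ => (lerayVertical i ξ : ℂ)) g x := by
  ext i
  change multiplier (velocitySymbol i₀ i₁ r c i) g x = r * multiplier (rotatedSymbol i₀ i₁ i) g x
    + c * multiplier (fun ξ => (lerayVertical i ξ : ℂ)) g x
  rw [← multiplier_const_mul, ← multiplier_const_mul,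
    ← multiplier_add hg (isSymbol_ofReal_mul (isSymbol_rotatedSymbol hS i₀ i₁ i) r)
      (isSymbol_ofReal_mul (isSymbol_lerayVertical hS i) c)]
  rfl

/-- The symbol of the pressure of the vertical force. -/
def pressureSymbol (ξ : Space d) : ℂ :=
  -(Complex.I * ((inner ℝ ξ (vertical d) / ‖ξ‖ ^ 2 : ℝ) : ℂ))

theorem isSymbol_pressureSymbol (hS : S ⊆ annulus d) :
    IsSymbol S ‖vertical d‖ (pressureSymbol : Space d → ℂ) := by
  have hm : Measurable fun ξ : Space d => inner ℝ ξ (vertical d) :=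
    (continuous_id.inner continuous_const).measurable
  refine ⟨by unfold pressureSymbol; fun_prop, fun ξ hξ => ?_⟩
  have h43 := (hS hξ).1
  unfold pressureSymbol
  rw [norm_neg, norm_mul, Complex.norm_I, one_mul, Complex.norm_real, Real.norm_eq_abs, abs_div,
    abs_of_pos (by positivity : 0 < ‖ξ‖ ^ 2), div_le_iff₀ (by positivity)]
  refine (abs_real_inner_le_norm _ _).trans ?_
  nlinarith [norm_nonneg (vertical d),
    mul_nonneg (norm_nonneg (vertical d)) (by nlinarith : 0 ≤ ‖ξ‖ ^ 2 - ‖ξ‖)]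

/-- The Helmholtz decomposition of the buoyancy force `a e_d`. -/
theorem lerayVertical_add_gradient (hg : IsProfile S g) (hS : S ⊆ annulus d) {a : Space d → ℝ}
    (ha : ∀ x, a x = multiplier (fun _ => 1) g x) (x : Space d) :
    vectorMultiplier (fun i ξ => (lerayVertical i ξ : ℂ)) g x + ∇ (multiplier pressureSymbol g) x
      = a x • vertical d := by
  have hR : ∀ ξ ∈ S, ‖ξ‖ ≤ 3 / 2 := fun ξ hξ => (hS hξ).2
  ext i
  have hp := isSymbol_pressureSymbol hS
  rw [PiLp.add_apply, gradient_coord, fderiv_multiplier_basisVec hg hp hR, PiLp.smul_apply, ha,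
    smul_eq_mul, mul_comm, ← multiplier_const_mul]
  change multiplier (fun ξ => (lerayVertical i ξ : ℂ)) g x + _ = _
  rw [← multiplier_add hg (isSymbol_lerayVertical hS i) (hp.deriv hR (by norm_num) i)]
  congr 1
  ext ξ
  have hI : Complex.I * Complex.I = -1 := Complex.I_mul_I
  simp only [derivSymbol, pressureSymbol, lerayVertical]
  push_cast
  linear_combination (-(ξ i : ℂ) * ((inner ℝ ξ (vertical d) : ℝ) : ℂ) / (‖ξ‖ : ℂ) ^ 2) * hI

theorem rotatedGradient_eq (hg : IsProfile S g) (hS : S ⊆ annulus d) (i₀ i₁ : Fin d)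
    {a : Space d → ℝ} (ha : a = multiplier (fun _ => 1) g) (x : Space d) :
    rotatedGradient i₀ i₁ a x = vectorMultiplier (rotatedSymbol i₀ i₁) g x := by
  have hd : ∀ i, pderiv i a x = multiplier (fun ξ => Complex.I * (ξ i : ℂ)) g x := by
    intro i
    unfold pderiv
    rw [ha, fderiv_multiplier_basisVec hg isSymbol_one fun ξ hξ => (hS hξ).2]
    congr 1
    ext ξ
    simp [derivSymbol]
  ext i
  simp only [rotatedGradient, vectorMultiplier]
  by_cases h0 : i = i₀
  · have e : rotatedSymbol i₀ i₁ i = fun ξ : Space d => Complex.I * (ξ i₁ : ℂ) := by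
      ext ξ
      simp only [rotatedSymbol, h0, if_true]
    rw [e, if_pos h0, hd]
  by_cases h1 : i = i₁
  · have e : rotatedSymbol i₀ i₁ i = fun ξ : Space d =>
        ((-1 : ℝ) : ℂ) * (Complex.I * (ξ i₀ : ℂ)) := by
      ext ξ
      rw [rotatedSymbol, if_neg h0, if_pos h1]
      simp
    rw [e, multiplier_const_mul, if_neg h0, if_pos h1, hd]
    ring
  · have e : rotatedSymbol i₀ i₁ i = fun _ : Space d => (0 : ℂ) := by
      ext ξ
      simp [rotatedSymbol, h0, h1]
    rw [e]
    simp [h0, h1, multiplier, Real.fourierInv_eq]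

/-- The explicit solution of the linearized system. -/
theorem isLinearSolution_multiplier (hg : IsProfile S g) (hS : S ⊆ annulus d) {i₀ i₁ : Fin d}
    (h01 : i₀ ≠ i₁) {a : Space d → ℝ} (ha : a = multiplier (fun _ => 1) g) {ν lam : ℝ}
    {c : ℝ → ℝ} (hc : ContDiff ℝ ∞ c) (hc0 : c 0 = 0)
    (hcd : ∀ t, HasDerivAt c (-ν * c t + Real.exp (-lam * t)) t) :
    IsLinearSolution ν lam (rotatedGradient i₀ i₁ a) a
      (fun t => vectorMultiplier (velocitySymbol i₀ i₁ (Real.exp (-ν * t)) (c t)) g)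
      (fun t => multiplier (fun _ => (Real.exp (-lam * t) : ℂ)) g) := by
  have hR : ∀ ξ ∈ S, ‖ξ‖ ≤ 3 / 2 := fun ξ hξ => (hS hξ).2
  have hexp : ∀ κ t : ℝ, HasDerivAt (fun t => Real.exp (-κ * t)) (-κ * Real.exp (-κ * t)) t := by
    intro κ t
    have := ((hasDerivAt_id t).const_mul (-κ)).exp
    simpa [mul_comm] using this
  have hΘ : ∀ t x, multiplier (fun _ => (Real.exp (-lam * t) : ℂ)) g x
      = Real.exp (-lam * t) * a x := by
    intro t x
    rw [ha, ← multiplier_const_mul]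
    simp
  have hrot := contDiff_vectorMultiplier hg hR (isSymbol_rotatedSymbol hS i₀ i₁)
  have hler := contDiff_vectorMultiplier hg hR (isSymbol_lerayVertical hS)
  have hac : ContDiff ℝ ∞ a := by
    rw [ha]
    exact contDiff_multiplier hg isSymbol_one hR
  have hU := vectorMultiplier_velocitySymbol hg hS i₀ i₁
  constructor
  · refine ContDiff.contDiffOn ?_
    simp_rw [hU]
    exact ((by fun_prop : ContDiff ℝ ∞ fun z : ℝ × Space d => Real.exp (-ν * z.1)).smul
      (hrot.comp contDiff_snd)).add ((hc.comp contDiff_fst).smul (hler.comp contDiff_snd))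
  · refine ContDiff.contDiffOn ?_
    simp_rw [hΘ]
    exact (by fun_prop : ContDiff ℝ ∞ fun z : ℝ × Space d => Real.exp (-lam * z.1)).mul
      (hac.comp contDiff_snd)
  · intro t _
    exact memLp_vectorMultiplier hg hR (isSymbol_velocitySymbol hS i₀ i₁ _ _)
  · have hp := contDiff_multiplier hg (isSymbol_pressureSymbol hS) hR
    refine ⟨fun t x => Real.exp (-lam * t) * multiplier pressureSymbol g x, fun t ht =>
      ⟨(hp.differentiable (by simp)).const_mul _, fun x => ?_⟩⟩
    have hgrad : ∇ (fun x => Real.exp (-lam * t) * multiplier pressureSymbol g x) x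
        = Real.exp (-lam * t) • ∇ (multiplier pressureSymbol g) x := by
      unfold gradient
      rw [fderiv_const_mul (hp.differentiable (by simp) x), map_smul]
    have hder : HasDerivAt
        (fun s => vectorMultiplier (velocitySymbol i₀ i₁ (Real.exp (-ν * s)) (c s)) g x)
        ((-ν * Real.exp (-ν * t)) • vectorMultiplier (rotatedSymbol i₀ i₁) g x
          + (-ν * c t + Real.exp (-lam * t)) •
            vectorMultiplier (fun i ξ => (lerayVertical i ξ : ℂ)) g x) t := by
      simp_rw [hU]
      exact ((hexp ν t).smul_const _).add ((hcd t).smul_const _)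
    rw [hder.hasDerivWithinAt.derivWithin (uniqueDiffOn_Ici 0 t ht), hgrad, hU, hΘ,
      mul_smul _ (a x), ← lerayVertical_add_gradient hg hS (congrFun ha) x]
    module
  · intro t ht x
    simp_rw [hΘ]
    rw [(((hexp lam t).mul_const (a x)).hasDerivWithinAt).derivWithin (uniqueDiffOn_Ici 0 t ht)]
    ring
  · intro t _ x
    rw [divergence_vectorMultiplier hg hR (by norm_num) (isSymbol_velocitySymbol hS i₀ i₁ _ _),
      multiplier_congr hg (m₂ := fun _ => 0) fun ξ hξ =>
        sum_derivSymbol_velocitySymbol hS h01 _ _ hξ]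
    simp [multiplier, Real.fourierInv_eq]
  · intro x
    rw [hU, rotatedGradient_eq hg hS i₀ i₁ ha, hc0]
    simp
  · intro x
    rw [hΘ]
    simp

end

/-! ### Time integration and the smallness estimate. -/

section

variable {d : ℕ} {S : Set (Space d)} {g : Space d → ℂ}

theorem lintegral_Ioi_const_mul_exp {A μ : ℝ} (hA : 0 ≤ A) (hμ : 0 < μ) :
    ∫⁻ t in Ioi (0 : ℝ), ENNReal.ofReal (A * Real.exp (-μ * t)) = ENNReal.ofReal (A / μ) := by
  rw [← ofReal_integral_eq_lintegral_ofReal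
    ((integrableOn_exp_mul_Ioi (neg_lt_zero.2 hμ) 0).const_mul A)
    (Filter.Eventually.of_forall fun t => by positivity), integral_const_mul,
    integral_exp_mul_Ioi (neg_lt_zero.2 hμ)]
  congr 1
  simp
  ring

theorem eLpNorm_vectorMultiplier_top_le {M : ℝ} (hg : IsProfile S g) {v : Fin d → Space d → ℂ}
    (hv : ∀ i, IsSymbol S M (v i)) :
    eLpNorm (vectorMultiplier v g) ⊤ volume
      ≤ d * (ENNReal.ofReal M * eLpNorm g 1 volume) := by
  rw [eLpNorm_exponent_top]
  refine eLpNormEssSup_le_of_ae_enorm_bound (Filter.Eventually.of_forall fun x => ?_)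
  refine (enorm_le_sum_enorm _).trans ?_
  refine (Finset.sum_le_sum fun i _ => enorm_multiplier_le hg (hv i) x).trans ?_
  simp

theorem eLpNorm_multiplier_top_le {M : ℝ} (hg : IsProfile S g) {m : Space d → ℂ}
    (hm : IsSymbol S M m) :
    eLpNorm (multiplier m g) ⊤ volume ≤ ENNReal.ofReal M * eLpNorm g 1 volume := by
  rw [eLpNorm_exponent_top]
  exact eLpNormEssSup_le_of_ae_enorm_bound
    (Filter.Eventually.of_forall fun x => enorm_multiplier_le hg hm x)

/-- Bounds of the forcing terms for an exponentially decaying thin velocity. -/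
theorem E0_F0_le {i₀ i₁ : Fin d} (h01 : i₀ ≠ i₁) (hg : IsProfile S g) (hS : S ⊆ annulus d)
    {ε M μ : ℝ} (hε : 0 ≤ ε) (hM : 0 ≤ M) (hμ : 0 < μ) (hthin : IsThin i₀ i₁ ε S)
    {v : ℝ → Fin d → Space d → ℂ} {m : ℝ → Space d → ℂ}
    (hv : ∀ t, 0 ≤ t → ∀ i, IsSymbol S (M * Real.exp (-μ * t)) (v t i))
    (hv01 : ∀ t, 0 ≤ t →
      IsSymbol S (M * Real.exp (-μ * t) * ε) (fun ξ => v t i₀ ξ + v t i₁ ξ))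
    (hm : ∀ t, 0 ≤ t → IsSymbol S (M * Real.exp (-μ * t)) (m t)) :
    E0 (fun t => vectorMultiplier (v t) g) (fun t => multiplier (m t) g)
      ≤ ENNReal.ofReal (54 * ε * M ^ 2 / μ) * (((∑ k ∈ Finset.range 4, d ^ k) * (d * d + d) : ℕ)
        * (eLpNorm g 1 volume * eLpNorm g 2 volume)) ∧
    F0 (fun t => vectorMultiplier (v t) g) (fun t => multiplier (m t) g)
      ≤ ENNReal.ofReal (M / μ) * ((d + 1 : ℕ) * eLpNorm g 1 volume) := by
  constructor
  · rw [← lintegral_Ioi_const_mul_exp (by positivity) hμ, ← lintegral_mul_const _ (by fun_prop)]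
    refine setLIntegral_mono' measurableSet_Ioi fun t ht => ?_
    have ht0 : (0 : ℝ) ≤ t := le_of_lt ht
    set E := Real.exp (-μ * t) with hE
    have hE0 : 0 < E := Real.exp_pos _
    -- The quadratic terms decay like `E²`, but `E² ≤ E` is enough and gives the same integral `1/μ`
    -- as for the linear ones.
    have hE1 : E ≤ 1 := Real.exp_le_one_iff.2 (by nlinarith)
    have hX : ENNReal.ofReal (54 * (ε * (M * E) * (M * E)))
        ≤ ENNReal.ofReal (54 * ε * M ^ 2 * E) := by
      refine ENNReal.ofReal_le_ofReal ?_
      have : E * E ≤ E := mul_le_of_le_one_left hE0.le hE1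
      calc _ = 54 * ε * M ^ 2 * (E * E) := by ring
        _ ≤ _ := by gcongr
    have b1 := (h3Bounded_convect_vector h01 hg hS hε hthin (by positivity) (by positivity)
      (hv t ht0) (hv01 t ht0) (hv t ht0)).h3Norm_le
    have b2 := (h3Bounded_convect h01 hg hS hε hthin (by positivity) (by positivity)
      (hv t ht0) (hv01 t ht0) (hm t ht0)).h3Norm_le
    refine (add_le_add b1 b2).trans ?_
    calc _ = ENNReal.ofReal (54 * (ε * (M * E) * (M * E))) *
          (((∑ k ∈ Finset.range 4, d ^ k) * (d * d + d) : ℕ)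
            * (eLpNorm g 1 volume * eLpNorm g 2 volume)) := by
          push_cast
          ring
      _ ≤ _ := by gcongr
  · rw [← lintegral_Ioi_const_mul_exp hM hμ, ← lintegral_mul_const _ (by fun_prop)]
    refine setLIntegral_mono' measurableSet_Ioi fun t ht => ?_
    have ht0 : (0 : ℝ) ≤ t := le_of_lt ht
    refine (add_le_add (eLpNorm_vectorMultiplier_top_le hg (hv t ht0))
      (eLpNorm_multiplier_top_le hg (hm t ht0))).trans (le_of_eq ?_)
    push_cast
    ring

theorem h3Norm_zero {F : Type*} [NormedAddCommGroup F] [NormedSpace ℝ F] :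
    h3Norm (0 : Space d → F) = 0 := by
  have h : H3Bounded 0 (0 : Space d → F) := by
    refine ⟨contDiff_const, fun k _ j => ?_⟩
    have e : iteratedFDeriv ℝ k (0 : Space d → F) = 0 := iteratedFDeriv_fun_zero
    simp [e]
  simpa using h.h3Norm_le

theorem smallnessLHS_zero_le {K A B : ℝ} (hK : 0 < K) (hA : 0 ≤ A) (hB : 0 ≤ B)
    {U : ℝ → Space d → Space d} {Θ : ℝ → Space d → ℝ} (hE : E0 U Θ ≤ ENNReal.ofReal A)
    (hF : F0 U Θ ≤ ENNReal.ofReal B) :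
    smallnessLHS K 0 0 U Θ ≤ A * Real.exp (K * B + K * A) := by
  have hE' : (E0 U Θ).toReal ≤ A := ENNReal.toReal_le_of_le_ofReal hA hE
  have hF' : (F0 U Θ).toReal ≤ B := ENNReal.toReal_le_of_le_ofReal hB hF
  unfold smallnessLHS
  rw [h3Norm_zero, h3Norm_zero]
  simp only [ENNReal.toReal_zero, ne_eq, OfNat.ofNat_ne_zero, not_false_eq_true, zero_pow,
    zero_add]
  gcongr

/-- The smallness estimate for initial data whose frequencies lie in a thin part of the annulus. -/
theorem exists_smallness_constant {i₀ i₁ : Fin d} (h01 : i₀ ≠ i₁) {ν lam K : ℝ} (hν : 0 < ν)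
    (hlam : 0 < lam) (hK : 0 < K) :
    ∃ C₀ : ℝ, 0 < C₀ ∧ ∀ C, C₀ ≤ C → ∀ (ε : ℝ), 0 < ε → ∀ S ⊆ annulus d, IsThin i₀ i₁ ε S →
      (∀ ξ ∈ S, |lerayVertical i₀ ξ + lerayVertical i₁ ξ| ≤ 3 * ε) →
      ∀ (a₀ : Space d → ℝ) (ha : MemLp (fun x => (a₀ x : ℂ)) 2 volume),
      ContDiff ℝ ∞ a₀ → HatSupportedIn ha S →
      (∃ (U : ℝ → Space d → Space d) (Θ : ℝ → Space d → ℝ),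
        IsLinearSolution ν lam (rotatedGradient i₀ i₁ a₀) a₀ U Θ) ∧
      ∀ (U : ℝ → Space d → Space d) (Θ : ℝ → Space d → ℝ),
        IsLinearSolution ν lam (rotatedGradient i₀ i₁ a₀) a₀ U Θ →
        E0 U Θ ≤ ENNReal.ofReal (C * ε * normL2 a₀ * normHatL1 ha) ∧
        F0 U Θ ≤ ENNReal.ofReal (C * normHatL1 ha) ∧
        smallnessLHS K 0 0 U Θ ≤
          C * ε * normL2 a₀ * normHatL1 ha *
            Real.exp (C * ε * normL2 a₀ * normHatL1 ha + C * normHatL1 ha) := by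
  have : NeZero d := ⟨fun h => by subst h; exact i₀.elim0⟩
  obtain ⟨c, μ, Cc, hμ, hCc, hc, hc0, hcd, hdecay⟩ := exists_duhamel_coefficient hν hlam
  -- `M` dominates three amplitudes: `3/2 + 2‖e_d‖Cc` for the velocity, `2 + 3Cc` for the sum of its
  -- two components, and `1` for the temperature.
  set M : ℝ := 4 + (3 + 2 * ‖vertical d‖) * Cc with hM
  have hM0 : 0 < M := by positivity
  set n : ℕ := (∑ k ∈ Finset.range 4, d ^ k) * (d * d + d) with hn
  set CE : ℝ := 54 * M ^ 2 / μ * n with hCE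
  set CF : ℝ := M / μ * (d + 1 : ℕ) with hCF
  have hCE0 : 0 ≤ CE := by positivity
  have hCF0 : 0 < CF := by positivity
  -- This constant dominates `CE`, `CF`, `K * CE` and `K * CF`, so the exponent `K` is absorbed as
  -- well.
  refine ⟨(CE + CF) * (1 + K), by positivity, fun C hC ε hε S hS hthin hleray a₀ ha ha_s hsupp => ?_⟩
  have hR : ∀ ξ ∈ S, ‖ξ‖ ≤ 3 / 2 := fun ξ hξ => (hS hξ).2
  have hg := isProfile_fourierL2 ha hR hsupp
  set g := fourierL2 ha with hgdef
  have hag : a₀ = multiplier (fun _ => 1) g := funext (eq_multiplier_one ha ha_s.continuous hg hR)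
  have hsol := isLinearSolution_multiplier hg hS h01 hag (ν := ν) (lam := lam) hc hc0 hcd
  refine ⟨⟨_, _, hsol⟩, fun U Θ hUΘ => ?_⟩
  have hL2 : 0 ≤ normL2 a₀ := ENNReal.toReal_nonneg
  have hL1 : 0 ≤ normHatL1 ha := ENNReal.toReal_nonneg
  have hN1 : eLpNorm g 1 volume ≤ ENNReal.ofReal (normHatL1 ha) :=
    eLpNorm_fourierL2_one_le ha hg.integrable
  have hN2 : eLpNorm g 2 volume = ENNReal.ofReal (normL2 a₀) := eLpNorm_fourierL2_two ha
  have hest := E0_F0_le h01 hg hS hε.le hM0.le hμ hthin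
    (v := fun t => velocitySymbol i₀ i₁ (Real.exp (-ν * t)) (c t))
    (m := fun t _ => (Real.exp (-lam * t) : ℂ)) ?_ ?_ ?_
  rotate_left
  · intro t ht i
    obtain ⟨h1, h2, -⟩ := hdecay t ht
    refine (isSymbol_velocitySymbol hS i₀ i₁ _ _ i).mono ?_
    rw [abs_of_pos (Real.exp_pos _), hM]
    have h3 := mul_le_mul_of_nonneg_right h1 (by positivity : 0 ≤ 2 * ‖vertical d‖)
    nlinarith [Real.exp_pos (-μ * t), mul_nonneg hCc (Real.exp_pos (-μ * t)).le]
  · intro t ht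
    obtain ⟨h1, h2, -⟩ := hdecay t ht
    refine (isSymbol_velocitySymbol_add hS h01 hthin hleray _ _).mono ?_
    rw [abs_of_pos (Real.exp_pos _)]
    have h3 : Real.exp (-ν * t) * 2 + |c t| * 3 ≤ M * Real.exp (-μ * t) := by
      have h4 := mul_nonneg (mul_nonneg (norm_nonneg (vertical d)) hCc) (Real.exp_pos (-μ * t)).le
      rw [hM]
      nlinarith [Real.exp_pos (-μ * t)]
    calc _ = (Real.exp (-ν * t) * 2 + |c t| * 3) * ε := by ring
      _ ≤ _ := mul_le_mul_of_nonneg_right h3 hε.le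
  · intro t ht
    refine ⟨measurable_const, fun ξ _ => ?_⟩
    rw [Complex.norm_real, Real.norm_of_nonneg (Real.exp_pos _).le]
    refine (hdecay t ht).2.2.trans (le_mul_of_one_le_left (Real.exp_pos _).le ?_)
    rw [hM]
    nlinarith [mul_nonneg hCc (norm_nonneg (vertical d))]
  obtain ⟨hE, hF⟩ := hest
  have hEU : E0 U Θ ≤ ENNReal.ofReal (CE * ε * normL2 a₀ * normHatL1 ha) := by
    -- By uniqueness an arbitrary solution agrees with the explicit one at all times that enter the
    -- integral.
    refine le_trans (le_of_eq (setLIntegral_congr_fun measurableSet_Ioi fun t ht => ?_))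
      (hE.trans ?_)
    · obtain ⟨e1, e2⟩ := hUΘ.unique hsol (le_of_lt ht)
      simp only [e1, e2]
    · rw [hN2]
      calc _ ≤ ENNReal.ofReal (54 * ε * M ^ 2 / μ) * ((n : ℝ≥0∞) *
            (ENNReal.ofReal (normHatL1 ha) * ENNReal.ofReal (normL2 a₀))) := by gcongr
        _ = _ := by
          rw [← ENNReal.ofReal_natCast, ← ENNReal.ofReal_mul hL1,
            ← ENNReal.ofReal_mul (by positivity), ← ENNReal.ofReal_mul (by positivity)]
          congr 1
          rw [hCE]
          ring
  have hFU : F0 U Θ ≤ ENNReal.ofReal (CF * normHatL1 ha) := by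
    refine le_trans (le_of_eq (setLIntegral_congr_fun measurableSet_Ioi fun t ht => ?_))
      (hF.trans ?_)
    · obtain ⟨e1, e2⟩ := hUΘ.unique hsol (le_of_lt ht)
      simp only [e1, e2]
    · calc _ ≤ ENNReal.ofReal (M / μ) * (((d + 1 : ℕ) : ℝ≥0∞) *
            ENNReal.ofReal (normHatL1 ha)) := by gcongr
        _ = _ := by
          rw [← ENNReal.ofReal_natCast, ← ENNReal.ofReal_mul (by positivity),
            ← ENNReal.ofReal_mul (by positivity)]
          congr 1
          rw [hCF]
          ring
  have c1 : CE ≤ C := by nlinarith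
  have c2 : CF ≤ C := by nlinarith
  have c3 : K * CE ≤ C := by nlinarith
  have c4 : K * CF ≤ C := by nlinarith
  have hX : 0 ≤ ε * normL2 a₀ * normHatL1 ha := by positivity
  have m1 : CE * ε * normL2 a₀ * normHatL1 ha ≤ C * ε * normL2 a₀ * normHatL1 ha := by gcongr
  refine ⟨hEU.trans (ENNReal.ofReal_le_ofReal m1),
    hFU.trans (ENNReal.ofReal_le_ofReal (by gcongr)), ?_⟩
  refine (smallnessLHS_zero_le hK (by positivity) (by positivity) hEU hFU).trans ?_
  have m2 : K * (CF * normHatL1 ha) ≤ C * normHatL1 ha := by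
    rw [← mul_assoc]
    gcongr
  have m3 : K * (CE * ε * normL2 a₀ * normHatL1 ha) ≤ C * ε * normL2 a₀ * normHatL1 ha := by
    calc _ = K * CE * (ε * normL2 a₀ * normHatL1 ha) := by ring
      _ ≤ C * (ε * normL2 a₀ * normHatL1 ha) := by gcongr
      _ = _ := by ring
  refine mul_le_mul m1 (Real.exp_le_exp.2 (by linarith)) (Real.exp_pos _).le ?_
  exact le_trans (by positivity) m1

/-! ### Geometry of the two thin sets. -/

theorem thinSet2_subset_annulus (ε : ℝ) : thinSet2 ε ⊆ annulus 2 := fun _ h => h.2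

theorem isThin_thinSet2 {ε : ℝ} (hε : 0 < ε) : IsThin 0 1 ε (thinSet2 ε) := by
  refine fun ξ hξ => ⟨?_, fun i h0 h1 => ?_⟩
  · rw [abs_sub_comm]
    linarith [hξ.1]
  · fin_cases i <;> simp_all

theorem isThin_thinSet3 {ε : ℝ} (hε : 0 < ε) : IsThin 0 1 ε (thinSet3 ε) := by
  refine fun ξ hξ => ⟨?_, fun i h0 h1 => ?_⟩
  · rw [abs_sub_comm]
    linarith [hξ.1]
  · fin_cases i
    · simp at h0
    · simp at h1
    · exact hξ.2.2.2

/-- Here `e_2` lies in the plane of the pair, and the sum equals `ξ₀(ξ₀-ξ₁)/|ξ|²`, small because of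
the difference. -/
theorem lerayVertical_thinSet2 {ε : ℝ} (ξ : Space 2) (hξ : ξ ∈ thinSet2 ε) :
    |lerayVertical 0 ξ + lerayVertical 1 ξ| ≤ 3 * ε := by
  have h1 : 4 / 3 ≤ ‖ξ‖ := hξ.2.1
  have hsq : ‖ξ‖ ^ 2 = ξ 0 ^ 2 + ξ 1 ^ 2 := by
    rw [EuclideanSpace.real_norm_sq_eq, Fin.sum_univ_two]
  have hin : inner ℝ ξ (vertical 2) = ξ 1 := by
    simp [PiLp.inner_apply, vertical, Fin.sum_univ_two]
  have hpos : 0 < ‖ξ‖ ^ 2 := by positivity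
  have e : lerayVertical 0 ξ + lerayVertical 1 ξ = ξ 0 * (ξ 0 - ξ 1) / ‖ξ‖ ^ 2 := by
    unfold lerayVertical
    rw [hin]
    simp only [vertical]
    field_simp
    rw [hsq]
    simp
    ring
  rw [e, abs_div, abs_mul, abs_of_pos hpos, div_le_iff₀ hpos]
  have h2 := abs_coord_le_norm ξ 0
  have h3 : |ξ 0 - ξ 1| ≤ ε := hξ.1
  have hε : 0 ≤ ε := (abs_nonneg _).trans h3
  calc |ξ 0| * |ξ 0 - ξ 1| ≤ ‖ξ‖ * ε := mul_le_mul h2 h3 (abs_nonneg _) (norm_nonneg _)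
    _ ≤ 3 * ε * ‖ξ‖ ^ 2 := by nlinarith [mul_nonneg hε (norm_nonneg ξ)]

/-- Here `e_3` is orthogonal to the pair, and the sum equals `-(ξ₀+ξ₁)ξ₂/|ξ|²`, small because the
vertical frequency is. -/
theorem lerayVertical_thinSet3 {ε : ℝ} (hS : thinSet3 ε ⊆ annulus 3) (ξ : Space 3)
    (hξ : ξ ∈ thinSet3 ε) : |lerayVertical 0 ξ + lerayVertical 1 ξ| ≤ 3 * ε := by
  have h1 : 4 / 3 ≤ ‖ξ‖ := (hS hξ).1
  have hin : inner ℝ ξ (vertical 3) = ξ 2 := by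
    simp [PiLp.inner_apply, vertical, Fin.sum_univ_three]
  have hpos : 0 < ‖ξ‖ ^ 2 := by positivity
  have e : lerayVertical 0 ξ + lerayVertical 1 ξ = -((ξ 0 + ξ 1) * ξ 2 / ‖ξ‖ ^ 2) := by
    unfold lerayVertical
    rw [hin]
    simp [vertical]
    ring
  rw [e, abs_neg, abs_div, abs_mul, abs_of_pos hpos, div_le_iff₀ hpos]
  have h2 : |ξ 0 + ξ 1| ≤ 2 * ‖ξ‖ := by
    linarith [abs_add_le (ξ 0) (ξ 1), abs_coord_le_norm ξ 0, abs_coord_le_norm ξ 1]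
  have h3 : |ξ 2| ≤ 2 * ε := hξ.2.2.2
  have hε : 0 ≤ ε := by linarith [abs_nonneg (ξ 2)]
  calc |ξ 0 + ξ 1| * |ξ 2| ≤ 2 * ‖ξ‖ * (2 * ε) :=
        mul_le_mul h2 h3 (abs_nonneg _) (by positivity)
    _ ≤ 3 * ε * ‖ξ‖ ^ 2 := by nlinarith [mul_nonneg hε (norm_nonneg ξ)]

theorem rotatedGradient_two (a : Space 2 → ℝ) : rotatedGradient 0 1 a = perpGrad2 a := by
  ext x i
  fin_cases i <;> simp [rotatedGradient, perpGrad2]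

theorem rotatedGradient_three (a : Space 3 → ℝ) : rotatedGradient 0 1 a = perpGrad3 a := by
  ext x i
  fin_cases i <;> simp [rotatedGradient, perpGrad3]

end

end DampedBoussinesq

end

open DampedBoussinesq in
theorem corollary1p1 (ν lam K : ℝ) (hν : 0 < ν) (hlam : 0 < lam) (hK : 0 < K) :
    ∃ C : ℝ, 0 < C ∧
      -- dimension two
      (∀ ε : ℝ, 0 < ε →
        ∀ (a₀ : Space 2 → ℝ) (ha : MemLp (fun x => (a₀ x : ℂ)) 2 volume),
        ContDiff ℝ ∞ a₀ → HatSupportedIn ha (thinSet2 ε) →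
        (∃ (U : ℝ → Space 2 → Space 2) (Θ : ℝ → Space 2 → ℝ),
          IsLinearSolution ν lam (perpGrad2 a₀) a₀ U Θ) ∧
        ∀ (U : ℝ → Space 2 → Space 2) (Θ : ℝ → Space 2 → ℝ),
          IsLinearSolution ν lam (perpGrad2 a₀) a₀ U Θ →
          E0 U Θ ≤ ENNReal.ofReal (C * ε * normL2 a₀ * normHatL1 ha) ∧
          F0 U Θ ≤ ENNReal.ofReal (C * normHatL1 ha) ∧
          smallnessLHS K 0 0 U Θ ≤
            C * ε * normL2 a₀ * normHatL1 ha *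
              Real.exp (C * ε * normL2 a₀ * normHatL1 ha + C * normHatL1 ha)) ∧
      -- dimension three
      (∀ ε : ℝ, 0 < ε → thinSet3 ε ⊆ annulus 3 →
        ∀ (a₀ : Space 3 → ℝ) (ha : MemLp (fun x => (a₀ x : ℂ)) 2 volume),
        ContDiff ℝ ∞ a₀ → HatSupportedIn ha (thinSet3 ε) →
        (∃ (U : ℝ → Space 3 → Space 3) (Θ : ℝ → Space 3 → ℝ),
          IsLinearSolution ν lam (perpGrad3 a₀) a₀ U Θ) ∧
        ∀ (U : ℝ → Space 3 → Space 3) (Θ : ℝ → Space 3 → ℝ),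
          IsLinearSolution ν lam (perpGrad3 a₀) a₀ U Θ →
          E0 U Θ ≤ ENNReal.ofReal (C * ε * normL2 a₀ * normHatL1 ha) ∧
          F0 U Θ ≤ ENNReal.ofReal (C * normHatL1 ha) ∧
          smallnessLHS K 0 0 U Θ ≤
            C * ε * normL2 a₀ * normHatL1 ha *
              Real.exp (C * ε * normL2 a₀ * normHatL1 ha + C * normHatL1 ha)) := by
  obtain ⟨C₂, hC₂, h₂⟩ := exists_smallness_constant (d := 2) (i₀ := 0) (i₁ := 1) (by decide)
    hν hlam hK
  obtain ⟨C₃, hC₃, h₃⟩ := exists_smallness_constant (d := 3) (i₀ := 0) (i₁ := 1) (by decide)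
    hν hlam hK
  -- Both estimates hold for every larger constant, so the maximum serves the two dimensions.
  refine ⟨max C₂ C₃, lt_max_of_lt_left hC₂, fun ε hε a₀ ha has hsupp => ?_,
    fun ε hε hS a₀ ha has hsupp => ?_⟩
  · rw [← rotatedGradient_two]
    exact h₂ _ (le_max_left _ _) ε hε _ (thinSet2_subset_annulus ε) (isThin_thinSet2 hε)
      lerayVertical_thinSet2 a₀ ha has hsupp
  · rw [← rotatedGradient_three]
    exact h₃ _ (le_max_right _ _) ε hε _ hS (isThin_thinSet3 hε)
      (lerayVertical_thinSet3 hS) a₀ ha has hsupp
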